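/- Let $a>0$, $0<|\alpha|<1$, let $0=x_0<x_1<\dots<x_n=a$ be nodes with multiplicities $m_0,\dots,m_n\ge 1$, $m_0=m_n=s+1$, and put $M=\sum_{j=0}^n m_j-1$ and $\mu=\max_j m_j$. Let $f\in C^{\mu+1}[0,a]$ be complex-valued, let $g\in C^{\mu+2}[0,a]$ be real-valued with $g(0)=0$ and $g'>0$ on $[0,a]$, and let $\phi_1,\dots,\phi_M\in C^{\mu+2}[0,a]$ be a Chebyshev set in the sense of Hermite interpolation: a linear combination of the $\phi_i$ that vanishes at finitely many points of $[0,a]$ with multiplicities at most $\mu$ adding up to $M$ is the trivial one. All these data are independent of $w$. Put $$f_1(x)=f(x)\Big(\frac{x}{g(x)}\Big)^{\alpha},\qquad f_2(x)=f(x)\log\frac{x}{g(x)}\qquad(x\ne 0),$$ with $f_1(0)=f(0)/g'(0)^\alpha$, $f_2(0)=f(0)\log\frac1{g'(0)}$, and $$\mathcal W[c_0,q](x)=iwg'(x)c_0+g(x)q'(x)+[1+\alpha+iwg(x)]g'(x)q(x).$$ For a function $F$, the collocation system with right-hand side $F$ asks for $c_0\in\mathbb C$ and $q=\sum_{i=1}^M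 c_i\phi_i$, $c_i\in\mathbb C$, such that $\mathcal W[c_0,q]^{(j)}(x_l)=F^{(j)}(x_l)$ for $0\le j\le m_l-1$, $0\le l\le n$. Consider (i) the system with right-hand side $f_1$ (solution $c_0,q_1$); (ii) the system with right-hand side $-q_1g'$ (solution $d_0,\ell_1$); (iii) the system with right-hand side $f_2(x)\big(x/g(x)\big)^\alpha$, extended continuously to $x=0$ (solution $e_0,r_1$). Then for all sufficiently large $w>0$ each of the three systems has a unique solution, i.e. a unique vector of coefficients. Define the Levin rule for $\int_0^a f(x)x^\alpha\log x\,e^{iwg(x)}dx$ by $$\begin{aligned}Q^{L,s}_{w,n}[f]={}&\Big[\big(g^{\alpha+1}r_1+e_0(1-e^{-iwg})g^\alpha+h_1\big)e^{iwg}\Big]_0^a\\&+\Big[\big((q_1\log g+\ell_1)g^{1+\alpha}+(c_0\log g+d_0)(1-e^{-iwg})g^\alpha+h_2\big)e^{iwg}\Big]_0^a,\end{aligned}$$ where the brackets at $x=0$ are understood as limits (and are equal to $0$) and $$h_1(x)=\alpha e_0e^{-iwg(x)}\int_0^x\frac{g'(t)(1-e^{iwg(t)})}{g(t)^{1-\alpha}}dt,$$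 $$h_2(x)=e^{-iwg(x)}\int_0^x\big(\alpha c_0\log g(t)+\alpha d_0+c_0\big)\frac{g'(t)(1-e^{iwg(t)})}{g(t)^{1-\alpha}}dt.$$ Then, as $w\to+\infty$, $$\int_0^a f(x)x^\alpha\log x\,e^{iwg(x)}dx-Q^{L,s}_{w,n}[f]=\mathcal O\big(\delta_\alpha(w)\,w^{-s-1-\min\{1+\alpha,1\}}\big),$$ where $\delta_\alpha(w)=1+|\ln w|$ for $\alpha\le 0$ and $\delta_\alpha(w)=1$ for $\alpha>0$; the implied constant does not depend on $w$. -/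

import Mathlib

open Set

noncomputable section

namespace LevinLog

/-- The largest multiplicity `max_l m_l`. -/
def maxMult {n : ℕ} (m : Fin (n + 1) → ℕ) : ℕ := Finset.univ.sup m

/-- The linear combination `∑ i, c_i φ_i`. -/
def comb {M : ℕ} (φ : Fin M → ℝ → ℂ) (c : Fin M → ℂ) : ℝ → ℂ :=
  fun x => ∑ i, c i * φ i x

/-- `{φ_1, …, φ_M}` is a Chebyshev set on `[0,a]`, zeros being counted with multiplicity up to `r`
(for `r = 1` this is the Haar condition): a linear combination which vanishes at points `z` of
`[0,a]` with multiplicities `k z ≤ r` that add up to `M` is the trivial one.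
Equivalently, each such Hermite interpolation problem is uniquely solvable. -/
def IsChebyshevSet {M : ℕ} (a : ℝ) (r : ℕ) (φ : Fin M → ℝ → ℂ) : Prop :=
  ∀ (Z : Finset ℝ) (k : ℝ → ℕ), (∀ z ∈ Z, z ∈ Icc 0 a ∧ k z ≤ r) → ∑ z ∈ Z, k z = M →
    ∀ c : Fin M → ℂ,
      (∀ z ∈ Z, ∀ j < k z, iteratedDerivWithin j (comb φ c) (Icc 0 a) z = 0) → c = 0

/-- The derivative `g'` on `[0,a]` (one-sided at the end points). -/
def dg (a : ℝ) (g : ℝ → ℝ) (x : ℝ) : ℝ := derivWithin g (Icc 0 a) x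

/-- `f₁(x) = f(x) (x / g(x))^α`, with its limit `f(0) / g'(0)^α` at `x = 0`. -/
def algPart (a α : ℝ) (g : ℝ → ℝ) (f : ℝ → ℂ) (x : ℝ) : ℂ :=
  if x = 0 then f 0 / ((dg a g 0 ^ α : ℝ) : ℂ) else f x * (((x / g x) ^ α : ℝ) : ℂ)

/-- `f₂(x) = f(x) log (x / g(x))`, with its limit `f(0) log (1 / g'(0))` at `x = 0`. -/
def logPart (a : ℝ) (g : ℝ → ℝ) (f : ℝ → ℂ) (x : ℝ) : ℂ :=
  if x = 0 then f 0 * (Real.log (1 / dg a g 0) : ℂ) else f x * (Real.log (x / g x) : ℂ)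

/-- The operator `𝒲[c₀,q] = i w g' c₀ + g q' + (1 + α + i w g) g' q` on `[0,a]`. -/
def WOp (a α w : ℝ) (g : ℝ → ℝ) (c₀ : ℂ) (q : ℝ → ℂ) (x : ℝ) : ℂ :=
  Complex.I * w * dg a g x * c₀ + g x * derivWithin q (Icc 0 a) x
    + (1 + α + Complex.I * w * g x) * dg a g x * q x

/-- `(c₀, c)` solves the collocation system with right-hand side `F`: for `q = ∑ i, c_i φ_i`, the
derivatives of `𝒲[c₀,q]` and of `F` agree at each node `x_l` up to the order `m_l - 1`. -/
def SolvesCollocation {n M : ℕ} (a α w : ℝ) (g : ℝ → ℝ) (φ : Fin M → ℝ → ℂ)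
    (x : Fin (n + 1) → ℝ) (m : Fin (n + 1) → ℕ) (F : ℝ → ℂ) (c : ℂ × (Fin M → ℂ)) : Prop :=
  ∀ l, ∀ j < m l,
    iteratedDerivWithin j (WOp a α w g c.1 (comb φ c.2)) (Icc 0 a) (x l)
      = iteratedDerivWithin j F (Icc 0 a) (x l)

/-- The solution `h` with `h(0) = 0` of `h' + i w g' h + α c₀ g' (1 - e^{-iwg}) / g^{1-α} = 0`. -/
def hAlg (a α w : ℝ) (g : ℝ → ℝ) (c₀ : ℂ) (x : ℝ) : ℂ :=
  α * c₀ * Complex.exp (-(Complex.I * w * g x)) *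
    ∫ t in (0 : ℝ)..x,
      dg a g t * (1 - Complex.exp (Complex.I * w * g t)) / ((g t ^ (1 - α) : ℝ) : ℂ)

/-- The solution `h` with `h(0) = 0` of
`h' + i w g' h + (α c₀ log g + α d₀ + c₀) g' (1 - e^{-iwg}) / g^{1-α} = 0`. -/
def hLog (a α w : ℝ) (g : ℝ → ℝ) (c₀ d₀ : ℂ) (x : ℝ) : ℂ :=
  Complex.exp (-(Complex.I * w * g x)) *
    ∫ t in (0 : ℝ)..x,
      (α * c₀ * Real.log (g t) + α * d₀ + c₀) *
        (dg a g t * (1 - Complex.exp (Complex.I * w * g t)) / ((g t ^ (1 - α) : ℝ) : ℂ))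

/-- `p(x) e^{iwg(x)}` with `p = g^{α+1} q + c₀ (1 - e^{-iwg}) g^α + h`.
For `-1 < α`, `α ≠ 0`, `g(0) = 0`, the value at `x = 0` is `0` (in Lean `0 ^ α = 0`), which is also
the limit as `x → 0+`. -/
def primAlg (a α w : ℝ) (g : ℝ → ℝ) (c₀ : ℂ) (q : ℝ → ℂ) (x : ℝ) : ℂ :=
  (((g x ^ (α + 1) : ℝ) : ℂ) * q x
      + c₀ * (1 - Complex.exp (-(Complex.I * w * g x))) * ((g x ^ α : ℝ) : ℂ)
      + hAlg a α w g c₀ x)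
    * Complex.exp (Complex.I * w * g x)

/-- `p(x) e^{iwg(x)}` with
`p = (q log g + ℓ) g^{1+α} + (c₀ log g + d₀) (1 - e^{-iwg}) g^α + h`.
For `-1 < α`, `α ≠ 0`, `g(0) = 0`, the value at `x = 0` is `0` (in Lean `0 ^ α = 0`), which is also
the limit as `x → 0+`. -/
def primLog (a α w : ℝ) (g : ℝ → ℝ) (c₀ d₀ : ℂ) (q ℓ : ℝ → ℂ) (x : ℝ) : ℂ :=
  ((q x * Real.log (g x) + ℓ x) * ((g x ^ (1 + α) : ℝ) : ℂ)
      + (c₀ * Real.log (g x) + d₀) * (1 - Complex.exp (-(Complex.I * w * g x)))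
          * ((g x ^ α : ℝ) : ℂ)
      + hLog a α w g c₀ d₀ x)
    * Complex.exp (Complex.I * w * g x)

/-- The Levin rule for `∫₀ᵃ f(x) x^α e^{iwg(x)} dx`, computed from the solution `e` of the
collocation system with right-hand side `f (x/g)^α`. -/
def levinAlg {M : ℕ} (a α w : ℝ) (g : ℝ → ℝ) (φ : Fin M → ℝ → ℂ)
    (e : ℂ × (Fin M → ℂ)) : ℂ :=
  primAlg a α w g e.1 (comb φ e.2) a - primAlg a α w g e.1 (comb φ e.2) 0

/-- The Levin rule for `∫₀ᵃ f(x) x^α log x e^{iwg(x)} dx`, computed from the solution `e` of the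
collocation system of the algebraic rule applied to `f₂`, the solution `c` of the system with
right-hand side `f₁`, and the solution `d` of the system with right-hand side `-q₁ g'`. -/
def levinLog {M : ℕ} (a α w : ℝ) (g : ℝ → ℝ) (φ : Fin M → ℝ → ℂ)
    (e c d : ℂ × (Fin M → ℂ)) : ℂ :=
  levinAlg a α w g φ e
    + (primLog a α w g c.1 d.1 (comb φ c.2) (comb φ d.2) a
        - primLog a α w g c.1 d.1 (comb φ c.2) (comb φ d.2) 0)

/-- The integral `∫₀ᵃ f(x) x^α log x e^{iwg(x)} dx`. -/
def oscIntegral (a α w : ℝ) (g : ℝ → ℝ) (f : ℝ → ℂ) : ℂ :=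
  ∫ x in (0 : ℝ)..a, f x * ((x ^ α * Real.log x : ℝ) : ℂ) * Complex.exp (Complex.I * w * g x)

/-- `δ_α(w) = 1 + |ln w|` if `α ≤ 0`, and `1` if `α > 0`. -/
def delta (α w : ℝ) : ℝ := if α ≤ 0 then 1 + |Real.log w| else 1

end LevinLog

end

/-! For x > 0, f x^α log x = g^α (f₁ log g + f₂ (x/g)^α), so every integral has the form `oscPair u
v` = ∫₀ᵃ g^α (u log g + v) e^{iwg}. The Levin rule is the exact value of `oscPair` with f₁ replaced
by 𝒲[c₀,q₁] and f₂ (x/g)^α by 𝒲[e₀,r₁] + 𝒲[d₀,ℓ₁] + q₁ g' (`levinLog_eq_oscPair`, from the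
antiderivative `primLog_sub_primLog`). Hence the error is the `oscPair` of two collocation residuals
(`oscIntegral_sub_levinLog`), and both vanish to order s+1 at 0 and at a.

Decay. Integration by parts (`mul_oscPair_eq_neg`) replaces (u, v) by (αu/g + (u/g')', αv/g +
(v/g')' + u/g) up to sign, gains a factor 1/w and costs one order of vanishing at each end point, so
it can be done s+1 times. What is left satisfies `exists_norm_oscillatory_le`, where no vanishing is
needed: one more integration by parts with e^{iwg} - 1 in place of e^{iwg}, the bound |e^{iwg} - 1|
≤ min(2, wg), and the substitution y = g(x), rescaled by t = wy when α < 0, give O(δ_α(w)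
w^{-min(1+α,1)}).

Uniformity. The residuals depend on w, but they are linear combinations of finitely many
w-independent functions with coefficients 1, -iwc and -c, where c stands for a collocation solution.
`exists_norm_oscPair_linComb_le` is uniform over such combinations with bounded coefficients, so it
suffices that w‖c‖ stays bounded. The collocation matrix is iwA + B, with A the Hermite
interpolation matrix of the functions g'(c₀ + gq). A is injective (`eq_zero_of_jets_eq_zero`):
evaluation at 0 gives c₀ = 0, then gq vanishes at the nodes, and dividing out the simple zero of g
at 0 leaves q with M zeros, so the Chebyshev property applies. The system is square, so for large w
it is invertible with inverse O(1/w) (`exists_forall_bijective_smul_add`). -/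

noncomputable section

/-! ### Smooth extension from a compact interval and Hadamard's lemma. -/

namespace LevinLog

open MeasureTheory intervalIntegral Filter Topology

variable {E : Type*} [NormedAddCommGroup E] [NormedSpace ℝ E]

theorem contDiffOn_derivWithin_Icc {a : ℝ} (ha : 0 < a) {u : ℝ → E} {k : ℕ}
    (hu : ContDiffOn ℝ ((k + 1 : ℕ) : WithTop ℕ∞) u (Icc 0 a)) :
    ContDiffOn ℝ (k : WithTop ℕ∞) (derivWithin u (Icc 0 a)) (Icc 0 a) :=
  hu.derivWithin (uniqueDiffOn_Icc ha) (by norm_cast)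

theorem hasDerivWithinAt_Icc {a : ℝ} {u : ℝ → E} {k : ℕ}
    (hu : ContDiffOn ℝ ((k + 1 : ℕ) : WithTop ℕ∞) u (Icc 0 a)) {x : ℝ} (hx : x ∈ Icc 0 a) :
    HasDerivWithinAt u (derivWithin u (Icc 0 a) x) (Icc 0 a) x :=
  (hu.differentiableOn (by norm_cast) x hx).hasDerivWithinAt

theorem hasDerivAt_Ioo {a : ℝ} {u : ℝ → E} {k : ℕ}
    (hu : ContDiffOn ℝ ((k + 1 : ℕ) : WithTop ℕ∞) u (Icc 0 a)) {x : ℝ} (hx : x ∈ Ioo 0 a) :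
    HasDerivAt u (derivWithin u (Icc 0 a) x) x :=
  (hasDerivWithinAt_Icc hu (Ioo_subset_Icc_self hx)).hasDerivAt (Icc_mem_nhds hx.1 hx.2)

/-- A `C^k` function on a compact interval extends to a `C^k` function on the line. -/
theorem exists_contDiff_extension [CompleteSpace E] {a : ℝ} (ha : 0 < a) (k : ℕ) (u : ℝ → E)
    (hu : ContDiffOn ℝ (k : WithTop ℕ∞) u (Icc 0 a)) :
    ∃ U : ℝ → E, ContDiff ℝ (k : WithTop ℕ∞) U ∧ EqOn U u (Icc 0 a) := by
  induction k generalizing u with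
  | zero =>
    refine ⟨IccExtend ha.le ((Icc 0 a).domRestrict u), ?_, fun x hx => ?_⟩
    · simp only [Nat.cast_zero, contDiff_zero]
      exact (continuousOn_iff_continuous_domRestrict.1 hu.continuousOn).Icc_extend'
    · rw [IccExtend_of_mem _ _ hx, domRestrict_apply]
  | succ k ih =>
    -- Extend the derivative, then integrate it back from 0.
    obtain ⟨W, hW, hWu⟩ := ih _ (contDiffOn_derivWithin_Icc ha hu)
    have hder : ∀ x, HasDerivAt (fun x => u 0 + ∫ t in (0 : ℝ)..x, W t) (W x) x := fun x =>
      (integral_hasDerivAt_right (hW.continuous.intervalIntegrable _ _)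
        (hW.continuous.stronglyMeasurableAtFilter _ _) hW.continuous.continuousAt).const_add _
    refine ⟨fun x => u 0 + ∫ t in (0 : ℝ)..x, W t, ?_, fun x hx => ?_⟩
    · have : ((k + 1 : ℕ) : WithTop ℕ∞) = (k : WithTop ℕ∞) + 1 := by norm_cast
      rw [this, contDiff_succ_iff_deriv]
      refine ⟨fun x => (hder x).differentiableAt, by simp, ?_⟩
      rwa [funext fun x => (hder x).deriv]
    · have : ∫ t in (0 : ℝ)..x, W t = u x - u 0 := by
        refine integral_eq_sub_of_hasDerivAt_of_le hx.1
          (hu.continuousOn.mono (Icc_subset_Icc_right hx.2)) (fun t ht => ?_)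
          (hW.continuous.intervalIntegrable _ _)
        have ht' : t ∈ Ioo 0 a := ⟨ht.1, ht.2.trans_le hx.2⟩
        rw [hWu (Ioo_subset_Icc_self ht')]
        exact hasDerivAt_Ioo hu ht'
      simp [this]

/-- The weight t^m makes the induction close, since differentiating in x brings out one more factor
t. -/
theorem contDiff_integral_pow_smul_comp_mul [CompleteSpace E] (k m : ℕ) (U : ℝ → E)
    (hU : ContDiff ℝ (k : WithTop ℕ∞) U) :
    ContDiff ℝ (k : WithTop ℕ∞) (fun x : ℝ => ∫ t in (0 : ℝ)..1, t ^ m • U (t * x)) := by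
  induction k generalizing m U with
  | zero =>
    simp only [Nat.cast_zero, contDiff_zero] at hU ⊢
    exact continuous_parametric_intervalIntegral_of_continuous' (by fun_prop) _ _
  | succ k ih =>
    have hk : ((k + 1 : ℕ) : WithTop ℕ∞) = (k : WithTop ℕ∞) + 1 := by norm_cast
    rw [hk, contDiff_succ_iff_deriv] at hU ⊢
    obtain ⟨hd, -, hU'⟩ := hU
    have hc' := hU'.continuous
    have hc := hd.continuous
    have key : ∀ x₀ : ℝ, HasDerivAt (fun x : ℝ => ∫ t in (0 : ℝ)..1, t ^ m • U (t * x))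
        (∫ t in (0 : ℝ)..1, t ^ (m + 1) • deriv U (t * x₀)) x₀ := by
      intro x₀
      have hcont : Continuous (fun p : ℝ × ℝ => p.2 ^ (m + 1) • deriv U (p.2 * p.1)) := by
        fun_prop
      obtain ⟨C, hC⟩ := ((isCompact_closedBall x₀ 1).prod (isCompact_Icc (a := (0 : ℝ)) (b := 1))
        ).exists_bound_of_continuousOn hcont.continuousOn
      refine (intervalIntegral.hasDerivAt_integral_of_dominated_loc_of_deriv_le
        (F' := fun x t => t ^ (m + 1) • deriv U (t * x)) (bound := fun _ => C)
        (Metric.closedBall_mem_nhds x₀ one_pos) ?_ ?_ ?_ ?_ ?_ ?_).2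
      · exact Eventually.of_forall fun x =>
          (by fun_prop : Continuous fun t : ℝ => t ^ m • U (t * x)).aestronglyMeasurable
      · exact (by fun_prop : Continuous fun t : ℝ => t ^ m • U (t * x₀)).intervalIntegrable _ _
      · exact (by fun_prop :
          Continuous fun t : ℝ => t ^ (m + 1) • deriv U (t * x₀)).aestronglyMeasurable
      · refine Eventually.of_forall fun t ht x hx => hC (x, t) ⟨hx, ?_⟩
        rw [uIoc_of_le zero_le_one] at ht
        exact Ioc_subset_Icc_self ht
      · exact intervalIntegrable_const
      · refine Eventually.of_forall fun t _ x _ => ?_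
        have h1 : HasDerivAt (fun x : ℝ => t * x) t x := by
          simpa using (hasDerivAt_id x).const_mul t
        have h2 := ((hd (t * x)).hasDerivAt.scomp x h1).const_smul (t ^ m)
        rw [smul_smul, ← pow_succ] at h2
        exact h2
    refine ⟨fun x => (key x).differentiableAt, by simp, ?_⟩
    rw [funext fun x => (key x).deriv]
    exact ih (m + 1) _ hU'

/-- Hadamard's lemma: the divided difference of a `C^{k+1}` function is `C^k`. -/
theorem exists_contDiffOn_sub_eq_smul [CompleteSpace E] {a : ℝ} (ha : 0 < a) {k : ℕ} {u : ℝ → E}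
    (hu : ContDiffOn ℝ ((k + 1 : ℕ) : WithTop ℕ∞) u (Icc 0 a)) :
    ∃ v : ℝ → E, ContDiffOn ℝ (k : WithTop ℕ∞) v (Icc 0 a) ∧
      (∀ x ∈ Icc 0 a, u x - u 0 = x • v x) ∧ v 0 = derivWithin u (Icc 0 a) 0 := by
  obtain ⟨U, hU, hUu⟩ := exists_contDiff_extension ha _ u hu
  have hk : ((k + 1 : ℕ) : WithTop ℕ∞) = (k : WithTop ℕ∞) + 1 := by norm_cast
  have hU1 := hU
  rw [hk, contDiff_succ_iff_deriv] at hU1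
  obtain ⟨hd, -, hU'⟩ := hU1
  have h0 : (0 : ℝ) ∈ Icc 0 a := ⟨le_rfl, ha.le⟩
  -- The quotient is the mean of U' over [0,x]; passing to the extension U makes two-sided
  -- derivatives available.
  refine ⟨fun x => ∫ t in (0 : ℝ)..1, t ^ 0 • deriv U (t * x),
    (contDiff_integral_pow_smul_comp_mul k 0 _ hU').contDiffOn, fun x hx => ?_, ?_⟩
  · rw [← hUu hx, ← hUu h0, ← intervalIntegral.integral_smul]
    have := integral_eq_sub_of_hasDerivAt (f := fun t : ℝ => U (t * x))
      (f' := fun t => x • (t ^ 0 • deriv U (t * x))) (a := 0) (b := 1) (fun t _ => ?_) ?_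
    · rw [this]; simp
    · have h1 : HasDerivAt (fun t : ℝ => t * x) x t := by
        simpa using (hasDerivAt_id t).mul_const x
      simp only [pow_zero, one_smul]
      exact (hd (t * x)).hasDerivAt.scomp t h1
    · have := hU'.continuous
      exact (by fun_prop :
        Continuous fun t : ℝ => x • (t ^ 0 • deriv U (t * x))).intervalIntegrable _ _
  · have : derivWithin u (Icc 0 a) 0 = deriv U 0 := by
      rw [← derivWithin_congr hUu (hUu h0)]
      exact (hd 0).derivWithin (uniqueDiffOn_Icc ha 0 h0)
    simp [this]

end LevinLog

/-! ### Vanishing to finite order at a point, under products and quotients. -/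

namespace LevinLog

/-- `u` vanishes at `p` with multiplicity at least `k`, relative to `[0,a]`. -/
def VanishesTo (a : ℝ) (k : ℕ) (u : ℝ → ℂ) (p : ℝ) : Prop :=
  ∀ j < k, iteratedDerivWithin j u (Icc 0 a) p = 0

section Vanishing

variable {a p : ℝ} {k : ℕ} {b u v : ℝ → ℂ}

theorem VanishesTo.mono {l : ℕ} (h : VanishesTo a k u p) (hl : l ≤ k) : VanishesTo a l u p :=
  fun j hj => h j (hj.trans_le hl)

theorem VanishesTo.apply_eq_zero (h : VanishesTo a (k + 1) u p) : u p = 0 := by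
  simpa using h 0 k.succ_pos

theorem VanishesTo.congr (h : VanishesTo a k u p) (hp : p ∈ Icc 0 a) (huv : EqOn u v (Icc 0 a)) :
    VanishesTo a k v p := fun j hj => by
  rw [← iteratedDerivWithin_congr huv hp]; exact h j hj

theorem VanishesTo.derivWithin (h : VanishesTo a (k + 1) u p) :
    VanishesTo a k (_root_.derivWithin u (Icc 0 a)) p := fun j hj => by
  rw [← iteratedDerivWithin_succ']; exact h (j + 1) (by omega)

theorem VanishesTo.const_mul (h : VanishesTo a k u p) (c : ℂ) :
    VanishesTo a k (fun x => c * u x) p := fun j hj => by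
  rw [iteratedDerivWithin_const_mul_field, h j hj, mul_zero]

theorem VanishesTo.add (ha : 0 < a) (hp : p ∈ Icc 0 a)
    (hu : ContDiffOn ℝ (k : WithTop ℕ∞) u (Icc 0 a))
    (hv : ContDiffOn ℝ (k : WithTop ℕ∞) v (Icc 0 a))
    (h : VanishesTo a k u p) (h' : VanishesTo a k v p) :
    VanishesTo a k (fun x => u x + v x) p := fun j hj => by
  have hj' : (j : WithTop ℕ∞) ≤ k := by exact_mod_cast hj.le
  rw [iteratedDerivWithin_fun_add hp (uniqueDiffOn_Icc ha) ((hu p hp).of_le hj')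
    ((hv p hp).of_le hj'), h j hj, h' j hj, add_zero]

theorem iteratedDerivWithin_mul_Icc (ha : 0 < a) (hp : p ∈ Icc 0 a) {j : ℕ}
    (hb : ContDiffOn ℝ (j : WithTop ℕ∞) b (Icc 0 a))
    (hu : ContDiffOn ℝ (j : WithTop ℕ∞) u (Icc 0 a)) :
    iteratedDerivWithin j (fun x => b x * u x) (Icc 0 a) p =
      ∑ i ∈ Finset.range (j + 1), j.choose i * iteratedDerivWithin i u (Icc 0 a) p *
        iteratedDerivWithin (j - i) b (Icc 0 a) p := by
  have := iteratedDerivWithin_mul hp (uniqueDiffOn_Icc ha) (hu p hp) (hb p hp)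
  rw [← this]
  congr 1
  ext x
  simp [mul_comm]

theorem VanishesTo.mul_left (ha : 0 < a) (hp : p ∈ Icc 0 a)
    (hb : ContDiffOn ℝ (k : WithTop ℕ∞) b (Icc 0 a))
    (hu : ContDiffOn ℝ (k : WithTop ℕ∞) u (Icc 0 a)) (h : VanishesTo a k u p) :
    VanishesTo a k (fun x => b x * u x) p := fun j hj => by
  have hj' : (j : WithTop ℕ∞) ≤ k := by exact_mod_cast hj.le
  rw [iteratedDerivWithin_mul_Icc ha hp (hb.of_le hj') (hu.of_le hj')]
  refine Finset.sum_eq_zero fun i hi => ?_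
  rw [h i (by simp at hi; omega)]
  ring

/-- Leibniz' formula is triangular in the derivatives of u, with diagonal entry b(p) ≠ 0. -/
theorem VanishesTo.of_mul_left (ha : 0 < a) (hp : p ∈ Icc 0 a)
    (hb : ContDiffOn ℝ (k : WithTop ℕ∞) b (Icc 0 a))
    (hu : ContDiffOn ℝ (k : WithTop ℕ∞) u (Icc 0 a)) (hbp : b p ≠ 0)
    (h : VanishesTo a k (fun x => b x * u x) p) : VanishesTo a k u p := by
  intro j
  induction j using Nat.strong_induction_on with
  | _ j ih =>
    intro hj
    have hj' : (j : WithTop ℕ∞) ≤ k := by exact_mod_cast hj.le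
    have h1 := h j hj
    rw [iteratedDerivWithin_mul_Icc ha hp (hb.of_le hj') (hu.of_le hj'), Finset.sum_range_succ,
      Finset.sum_eq_zero fun i hi => ?_] at h1
    · simpa [hbp] using h1
    · have hi' := Finset.mem_range.1 hi
      rw [ih i hi' (hi'.trans hj)]
      ring

/-- In Leibniz' formula at order j+1 the top term dies because b(p) = 0 and the terms below j die by
induction, leaving (j+1) u^{(j)}(p) b'(p). One order is spent on the zero of b. -/
theorem VanishesTo.of_mul_left_of_simple_zero (ha : 0 < a) (hp : p ∈ Icc 0 a)
    (hb : ContDiffOn ℝ (k : WithTop ℕ∞) b (Icc 0 a))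
    (hu : ContDiffOn ℝ (k : WithTop ℕ∞) u (Icc 0 a)) (hbp : b p = 0)
    (hbp' : _root_.derivWithin b (Icc 0 a) p ≠ 0)
    (h : VanishesTo a (k + 1) (fun x => b x * u x) p) : VanishesTo a k u p := by
  intro j
  induction j using Nat.strong_induction_on with
  | _ j ih =>
    intro hj
    have hj' : ((j + 1 : ℕ) : WithTop ℕ∞) ≤ k := by exact_mod_cast hj
    have h1 := h (j + 1) (by omega)
    rw [iteratedDerivWithin_mul_Icc ha hp (hb.of_le hj') (hu.of_le hj'), Finset.sum_range_succ,
      Finset.sum_range_succ, Finset.sum_eq_zero fun i hi => ?_] at h1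
    · simpa [hbp, hbp', iteratedDerivWithin_one, Nat.cast_add_one_ne_zero] using h1
    · have hi' := Finset.mem_range.1 hi
      rw [ih i hi' (hi'.trans hj)]
      ring

end Vanishing

/-! ### The phase function and division by it. -/

/-- `g` is a `C^{N+2}` phase function on `[0,a]`: it vanishes at `0` and has positive derivative. -/
structure IsPhase (a : ℝ) (N : ℕ) (g : ℝ → ℝ) : Prop where
  pos : 0 < a
  contDiffOn : ContDiffOn ℝ ((N + 2 : ℕ) : WithTop ℕ∞) g (Icc 0 a)
  map_zero : g 0 = 0
  dg_pos : ∀ t ∈ Icc 0 a, 0 < dg a g t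

namespace IsPhase

variable {a : ℝ} {N : ℕ} {g : ℝ → ℝ} (h : IsPhase a N g)
include h

theorem mono {K : ℕ} (hK : K ≤ N) : IsPhase a K g :=
  ⟨h.pos, h.contDiffOn.of_le (by exact_mod_cast (by omega)), h.map_zero, h.dg_pos⟩

theorem zero_mem : (0 : ℝ) ∈ Icc 0 a := ⟨le_rfl, h.pos.le⟩

theorem right_mem : a ∈ Icc 0 a := ⟨h.pos.le, le_rfl⟩

theorem contDiffOn_ofReal :
    ContDiffOn ℝ ((N + 2 : ℕ) : WithTop ℕ∞) (fun x => (g x : ℂ)) (Icc 0 a) :=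
  Complex.ofRealCLM.contDiff.comp_contDiffOn h.contDiffOn

theorem contDiffOn_dg : ContDiffOn ℝ ((N + 1 : ℕ) : WithTop ℕ∞) (dg a g) (Icc 0 a) :=
  contDiffOn_derivWithin_Icc h.pos h.contDiffOn

theorem contDiffOn_ofReal_dg :
    ContDiffOn ℝ ((N + 1 : ℕ) : WithTop ℕ∞) (fun x => (dg a g x : ℂ)) (Icc 0 a) :=
  Complex.ofRealCLM.contDiff.comp_contDiffOn h.contDiffOn_dg

theorem ofReal_dg_ne_zero {x : ℝ} (hx : x ∈ Icc 0 a) : (dg a g x : ℂ) ≠ 0 := by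
  exact_mod_cast (h.dg_pos x hx).ne'

theorem hasDerivWithinAt {x : ℝ} (hx : x ∈ Icc 0 a) :
    HasDerivWithinAt g (dg a g x) (Icc 0 a) x :=
  hasDerivWithinAt_Icc (k := N + 1) h.contDiffOn hx

theorem hasDerivAt {x : ℝ} (hx : x ∈ Ioo 0 a) : HasDerivAt g (dg a g x) x :=
  hasDerivAt_Ioo (k := N + 1) h.contDiffOn hx

theorem derivWithin_ofReal {x : ℝ} (hx : x ∈ Icc 0 a) :
    derivWithin (fun x => (g x : ℂ)) (Icc 0 a) x = dg a g x :=
  (h.hasDerivWithinAt hx).ofReal_comp.derivWithin (uniqueDiffOn_Icc h.pos x hx)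

theorem strictMonoOn : StrictMonoOn g (Icc 0 a) := by
  refine strictMonoOn_of_deriv_pos (convex_Icc _ _) h.contDiffOn.continuousOn fun x hx => ?_
  rw [interior_Icc] at hx
  rw [(h.hasDerivAt hx).deriv]
  exact h.dg_pos x (Ioo_subset_Icc_self hx)

theorem apply_pos {x : ℝ} (hx : x ∈ Ioc 0 a) : 0 < g x := by
  simpa [h.map_zero] using h.strictMonoOn h.zero_mem (Ioc_subset_Icc_self hx) hx.1

theorem apply_nonneg {x : ℝ} (hx : x ∈ Icc 0 a) : 0 ≤ g x := by
  simpa [h.map_zero] using h.strictMonoOn.monotoneOn h.zero_mem hx hx.1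

theorem apply_le {x : ℝ} (hx : x ∈ Icc 0 a) : g x ≤ g a :=
  h.strictMonoOn.monotoneOn hx h.right_mem hx.2

/-- The phase is `x γ(x)` with a positive `C^{N+1}` function `γ`. -/
theorem exists_eq_mul : ∃ γ : ℝ → ℝ, ContDiffOn ℝ ((N + 1 : ℕ) : WithTop ℕ∞) γ (Icc 0 a) ∧
    (∀ x ∈ Icc 0 a, g x = x * γ x) ∧ (∀ x ∈ Icc 0 a, 0 < γ x) ∧ γ 0 = dg a g 0 := by
  obtain ⟨γ, hγ, hg, h0⟩ := exists_contDiffOn_sub_eq_smul h.pos h.contDiffOn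
  have hg' : ∀ x ∈ Icc 0 a, g x = x * γ x := fun x hx => by
    simpa [h.map_zero] using hg x hx
  refine ⟨γ, hγ, hg', fun x hx => ?_, h0⟩
  rcases hx.1.eq_or_lt with rfl | hx0
  · rw [h0]; exact h.dg_pos _ h.zero_mem
  · have := h.apply_pos ⟨hx0, hx.2⟩
    rw [hg' x hx] at this
    exact pos_of_mul_pos_right this hx0.le

/-- Division by the phase of a function which vanishes at `0`. -/
theorem exists_sub_eq_mul {k : ℕ} (hk : k ≤ N + 1) {u : ℝ → ℂ}
    (hu : ContDiffOn ℝ ((k + 1 : ℕ) : WithTop ℕ∞) u (Icc 0 a)) :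
    ∃ v : ℝ → ℂ, ContDiffOn ℝ (k : WithTop ℕ∞) v (Icc 0 a) ∧
      ∀ x ∈ Icc 0 a, u x - u 0 = g x * v x := by
  obtain ⟨γ, hγ, hg, hpos, -⟩ := h.exists_eq_mul
  obtain ⟨v, hv, huv, -⟩ := exists_contDiffOn_sub_eq_smul h.pos hu
  have hγ' : ContDiffOn ℝ (k : WithTop ℕ∞) (fun x => (γ x : ℂ)) (Icc 0 a) :=
    Complex.ofRealCLM.contDiff.comp_contDiffOn (hγ.of_le (by exact_mod_cast hk))
  have hne : ∀ x ∈ Icc 0 a, (γ x : ℂ) ≠ 0 := fun x hx => by exact_mod_cast (hpos x hx).ne'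
  refine ⟨fun x => v x * (γ x : ℂ)⁻¹, hv.mul (hγ'.inv hne), fun x hx => ?_⟩
  have := hne x hx
  rw [huv x hx, hg x hx]
  push_cast
  field_simp
  simp

end IsPhase

end LevinLog

/-! ### Logarithmic weights, integrability, and the fundamental theorem with weight g^α log g. -/

namespace LevinLog

open MeasureTheory Filter Topology

/-- Apply log t ≤ t^ε/ε to t and to 1/t; the sum of the two bounds serves both signs of the
logarithm. -/
theorem abs_log_le_rpow {ε t : ℝ} (hε : 0 < ε) (ht : 0 < t) :
    |Real.log t| ≤ (t ^ ε + t ^ (-ε)) / ε := by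
  have h1 := Real.log_le_rpow_div ht.le hε
  have h2 := Real.log_le_rpow_div (inv_pos.2 ht).le hε
  rw [Real.log_inv, Real.inv_rpow ht.le, ← Real.rpow_neg ht.le] at h2
  have h3 : 0 ≤ t ^ ε / ε := by positivity
  have h4 : 0 ≤ t ^ (-ε) / ε := by positivity
  rw [add_div, abs_le]
  constructor <;> linarith

/-- The weight `t^r (1 + |log t|)`. -/
def logWeight (r t : ℝ) : ℝ := t ^ r * (1 + |Real.log t|)

theorem measurable_logWeight (r : ℝ) : Measurable (logWeight r) := by
  unfold logWeight; fun_prop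

theorem logWeight_nonneg (r : ℝ) {t : ℝ} (ht : 0 ≤ t) : 0 ≤ logWeight r t := by
  unfold logWeight; positivity

theorem logWeight_le {r ε t : ℝ} (hε : 0 < ε) (ht : 0 < t) :
    logWeight r t ≤ t ^ r + (t ^ (r + ε) + t ^ (r - ε)) / ε := by
  have h := mul_le_mul_of_nonneg_left (abs_log_le_rpow hε ht) (Real.rpow_nonneg ht.le r)
  rw [logWeight, mul_add, mul_one, Real.rpow_add ht, sub_eq_add_neg, Real.rpow_add ht]
  calc _ ≤ t ^ r + t ^ r * ((t ^ ε + t ^ (-ε)) / ε) := by linarith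
    _ = _ := by ring

theorem integrableOn_logWeight_Ioc {r : ℝ} (hr : -1 < r) (b : ℝ) :
    IntegrableOn (logWeight r) (Ioc 0 b) := by
  -- Half the distance from r to -1, so that r - ε is still above -1.
  set ε := (r + 1) / 2 with hε
  have hε0 : 0 < ε := by linarith
  have key : ∀ q : ℝ, -1 < q → IntegrableOn (fun t : ℝ => t ^ q) (Ioc 0 b) := fun q hq =>
    (intervalIntegral.intervalIntegrable_rpow' hq).1
  have hint : IntegrableOn (fun t : ℝ => t ^ r + (t ^ (r + ε) + t ^ (r - ε)) / ε) (Ioc 0 b) :=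
    (key r hr).add (((key _ (by linarith)).add (key _ (by linarith))).div_const ε)
  refine hint.mono' (measurable_logWeight r).aestronglyMeasurable ?_
  filter_upwards [ae_restrict_mem measurableSet_Ioc] with t ht
  rw [Real.norm_of_nonneg (logWeight_nonneg r ht.1.le)]
  exact logWeight_le hε0 ht.1

theorem integrableOn_logWeight_Ioi {r : ℝ} (hr : r < -1) :
    IntegrableOn (logWeight r) (Ioi 1) := by
  -- Half the distance again, now keeping r + ε below -1.
  set ε := -(r + 1) / 2 with hε
  have hε0 : 0 < ε := by linarith
  have key : ∀ q : ℝ, q < -1 → IntegrableOn (fun t : ℝ => t ^ q) (Ioi 1) := fun q hq =>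
    integrableOn_Ioi_rpow_of_lt hq one_pos
  have hint : IntegrableOn (fun t : ℝ => t ^ r + (t ^ (r + ε) + t ^ (r - ε)) / ε) (Ioi 1) :=
    (key r hr).add (((key _ (by linarith)).add (key _ (by linarith))).div_const ε)
  refine hint.mono' (measurable_logWeight r).aestronglyMeasurable ?_
  filter_upwards [ae_restrict_mem measurableSet_Ioi] with t ht
  have ht0 : 0 < t := one_pos.trans ht
  rw [Real.norm_of_nonneg (logWeight_nonneg r ht0.le)]
  exact logWeight_le hε0 ht0

theorem continuous_rpow_mul_log {r : ℝ} (hr : 0 < r) :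
    ContinuousOn (fun t : ℝ => t ^ r * Real.log t) (Ici 0) := by
  intro t ht
  rcases (mem_Ici.1 ht).eq_or_lt with rfl | ht0
  · have h0 : (0 : ℝ) ^ r * Real.log 0 = 0 := by simp
    rw [ContinuousWithinAt, h0, ← Ioi_insert, nhdsWithin_insert, tendsto_sup]
    refine ⟨?_, ?_⟩
    · rw [tendsto_pure_left]
      intro s hs
      simpa using mem_of_mem_nhds hs
    · simpa only [mul_comm] using tendsto_log_mul_rpow_nhdsGT_zero hr
  · exact ((Real.continuousAt_rpow_const _ _ (Or.inl ht0.ne')).mul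
      (Real.continuousAt_log ht0.ne')).continuousWithinAt

namespace IsPhase

variable {a α : ℝ} {N : ℕ} {g : ℝ → ℝ} (h : IsPhase a N g)
include h

theorem image_Ioc_subset : g '' Ioc 0 a ⊆ Ioc 0 (g a) := by
  rintro _ ⟨x, hx, rfl⟩
  exact ⟨h.apply_pos hx, h.apply_le (Ioc_subset_Icc_self hx)⟩

theorem injOn : InjOn g (Ioc 0 a) := h.strictMonoOn.injOn.mono Ioc_subset_Icc_self

theorem integrableOn_dg_mul_comp {F : ℝ → ℝ} (hF : IntegrableOn F (Ioc 0 (g a))) :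
    IntegrableOn (fun x => dg a g x * F (g x)) (Ioc 0 a) := by
  have h1 := (integrableOn_image_iff_integrableOn_abs_deriv_smul measurableSet_Ioc
    (fun x hx => (h.hasDerivWithinAt (Ioc_subset_Icc_self hx)).mono Ioc_subset_Icc_self)
    h.injOn F).1 (hF.mono_set h.image_Ioc_subset)
  refine h1.congr_fun (fun x hx => ?_) measurableSet_Ioc
  simp [abs_of_pos (h.dg_pos x (Ioc_subset_Icc_self hx))]

theorem integral_dg_mul_comp_le {F : ℝ → ℝ} {s : Set ℝ} (hs : MeasurableSet s)
    (hs' : Ioc 0 (g a) ⊆ s) (hF : IntegrableOn F s) (hF0 : ∀ y ∈ s, 0 ≤ F y) :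
    ∫ x in (0 : ℝ)..a, dg a g x * F (g x) ≤ ∫ y in s, F y := by
  rw [intervalIntegral.integral_of_le h.pos.le]
  have h1 := integral_image_eq_integral_abs_deriv_smul measurableSet_Ioc
    (fun x hx => (h.hasDerivWithinAt (Ioc_subset_Icc_self hx)).mono Ioc_subset_Icc_self)
    h.injOn F
  have h2 : ∫ x in Ioc 0 a, dg a g x * F (g x) = ∫ x in Ioc 0 a, |dg a g x| • F (g x) :=
    setIntegral_congr_fun measurableSet_Ioc fun x hx => by
      simp [abs_of_pos (h.dg_pos x (Ioc_subset_Icc_self hx))]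
  rw [h2, ← h1]
  refine setIntegral_mono_set hF ?_ (h.image_Ioc_subset.trans hs').eventuallyLE
  filter_upwards [ae_restrict_mem hs] with y hy using hF0 y hy

theorem exists_dg_lower : ∃ κ > 0, ∀ x ∈ Icc 0 a, κ ≤ dg a g x := by
  obtain ⟨x₀, hx₀, hmin⟩ := isCompact_Icc.exists_isMinOn ⟨0, h.zero_mem⟩
    h.contDiffOn_dg.continuousOn
  exact ⟨_, h.dg_pos x₀ hx₀, fun x hx => hmin hx⟩

/-- Change of variables controls g'·F(g); the lower bound g' ≥ κ > 0 then removes the factor g'. -/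
theorem integrableOn_logWeight_comp {r : ℝ} (hr : -1 < r) :
    IntegrableOn (fun x => logWeight r (g x)) (Ioc 0 a) := by
  have h1 := h.integrableOn_dg_mul_comp (integrableOn_logWeight_Ioc hr (g a))
  obtain ⟨κ, hκ, hle⟩ := h.exists_dg_lower
  have hm : AEStronglyMeasurable (fun x => logWeight r (g x)) (volume.restrict (Ioc 0 a)) :=
    ((measurable_logWeight r).comp_aemeasurable
      ((h.contDiffOn.continuousOn.mono Ioc_subset_Icc_self).aemeasurable
        measurableSet_Ioc)).aestronglyMeasurable
  refine (h1.const_mul κ⁻¹).mono' hm ?_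
  filter_upwards [ae_restrict_mem measurableSet_Ioc] with x hx
  have h0 := logWeight_nonneg r (h.apply_pos hx).le
  rw [Real.norm_of_nonneg h0, ← mul_assoc]
  refine le_mul_of_one_le_left h0 ?_
  rw [← div_eq_inv_mul, le_div_iff₀ hκ, one_mul]
  exact hle x (Ioc_subset_Icc_self hx)

theorem intervalIntegrable_of_norm_le {r C : ℝ} (hr : -1 < r) {K : ℝ → ℂ}
    (hK : ContinuousOn K (Ioc 0 a)) (hle : ∀ x ∈ Ioc 0 a, ‖K x‖ ≤ C * logWeight r (g x)) :
    IntervalIntegrable K volume 0 a := by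
  rw [intervalIntegrable_iff_integrableOn_Ioc_of_le h.pos.le]
  refine ((h.integrableOn_logWeight_comp hr).const_mul C).mono'
    (hK.aestronglyMeasurable measurableSet_Ioc) ?_
  filter_upwards [ae_restrict_mem measurableSet_Ioc] with x hx using hle x hx

theorem continuousOn_rpow (r : ℝ) : ContinuousOn (fun x => ((g x ^ r : ℝ) : ℂ)) (Ioc 0 a) :=
  Complex.continuous_ofReal.comp_continuousOn
    ((h.contDiffOn.continuousOn.mono Ioc_subset_Icc_self).rpow_const fun _ hx =>
      Or.inl (h.apply_pos hx).ne')

theorem continuousOn_log : ContinuousOn (fun x => (Real.log (g x) : ℂ)) (Ioc 0 a) :=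
  Complex.continuous_ofReal.comp_continuousOn
    ((h.contDiffOn.continuousOn.mono Ioc_subset_Icc_self).log fun _ hx => (h.apply_pos hx).ne')

/-- Supplies the integrability required by the fundamental theorem below and by every `oscPair`. -/
theorem intervalIntegrable_rpow_mul {r : ℝ} (hr : -1 < r) {A B : ℝ → ℂ}
    (hA : ContinuousOn A (Icc 0 a)) (hB : ContinuousOn B (Icc 0 a)) :
    IntervalIntegrable
      (fun x => ((g x ^ r : ℝ) : ℂ) * (Real.log (g x) * A x + B x)) volume 0 a := by
  obtain ⟨CA, hCA⟩ := isCompact_Icc.exists_bound_of_continuousOn hA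
  obtain ⟨CB, hCB⟩ := isCompact_Icc.exists_bound_of_continuousOn hB
  refine h.intervalIntegrable_of_norm_le (C := CA + CB) hr ?_ fun x hx => ?_
  · exact (h.continuousOn_rpow r).mul ((h.continuousOn_log.mul (hA.mono Ioc_subset_Icc_self)).add
      (hB.mono Ioc_subset_Icc_self))
  · have hx' := Ioc_subset_Icc_self hx
    have h1 : 0 ≤ g x ^ r := Real.rpow_nonneg (h.apply_nonneg hx') _
    have hA0 := (norm_nonneg _).trans (hCA x hx')
    have hB0 := (norm_nonneg _).trans (hCB x hx')
    rw [norm_mul, Complex.norm_real, Real.norm_of_nonneg h1, logWeight, mul_left_comm]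
    refine mul_le_mul_of_nonneg_left ((norm_add_le _ _).trans ?_) h1
    rw [norm_mul, Complex.norm_real, Real.norm_eq_abs]
    have := mul_le_mul_of_nonneg_left (hCA x hx') (abs_nonneg (Real.log (g x)))
    have := hCB x hx'
    have := mul_nonneg hB0 (abs_nonneg (Real.log (g x)))
    nlinarith

/-- Fundamental theorem of calculus for `g^α (P₁ log g + P₂)`, where `P₁ = g v₁`, `P₂ = g v₂`. -/
theorem integral_rpow_mul_log (hα : -1 < α) {P₁ P₂ v₁ v₂ : ℝ → ℂ}
    (hP₁ : ContDiffOn ℝ 1 P₁ (Icc 0 a)) (hP₂ : ContDiffOn ℝ 1 P₂ (Icc 0 a))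
    (hv₁ : ContinuousOn v₁ (Icc 0 a)) (hv₂ : ContinuousOn v₂ (Icc 0 a))
    (h₁ : ∀ x ∈ Icc 0 a, P₁ x = g x * v₁ x) (h₂ : ∀ x ∈ Icc 0 a, P₂ x = g x * v₂ x) :
    ∫ x in (0 : ℝ)..a, ((g x ^ α : ℝ) : ℂ) *
        (Real.log (g x) * (α * dg a g x * v₁ x + derivWithin P₁ (Icc 0 a) x)
          + (dg a g x * v₁ x + α * dg a g x * v₂ x + derivWithin P₂ (Icc 0 a) x)) =
      ((g a ^ α : ℝ) : ℂ) * (Real.log (g a) * P₁ a + P₂ a) := by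
  have hP₁' : ContDiffOn ℝ ((0 + 1 : ℕ) : WithTop ℕ∞) P₁ (Icc 0 a) := by simpa using hP₁
  have hP₂' : ContDiffOn ℝ ((0 + 1 : ℕ) : WithTop ℕ∞) P₂ (Icc 0 a) := by simpa using hP₂
  have hc₁ := (contDiffOn_derivWithin_Icc h.pos hP₁').continuousOn
  have hc₂ := (contDiffOn_derivWithin_Icc h.pos hP₂').continuousOn
  have hdg := h.contDiffOn_ofReal_dg.continuousOn
  have hg := h.contDiffOn.continuousOn
  have hmaps : MapsTo g (Icc 0 a) (Ici 0) := fun x hx => h.apply_nonneg hx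
  -- A factor g of P₁ and P₂ is absorbed into the power: the exponent α + 1 > 0 makes G continuous
  -- at 0, with G(0) = 0, even when α < 0. In the interior G is differentiated in the form g^α (P₁
  -- log g + P₂), so v₁ and v₂ need only be continuous.
  set G : ℝ → ℂ := fun x => ((g x ^ (α + 1) * Real.log (g x) : ℝ) : ℂ) * v₁ x
    + ((g x ^ (α + 1) : ℝ) : ℂ) * v₂ x with hG
  have hGeq : ∀ x ∈ Ioc 0 a, G x = ((g x ^ α : ℝ) : ℂ) * (Real.log (g x) * P₁ x + P₂ x) := by
    intro x hx
    have hx' := Ioc_subset_Icc_self hx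
    simp only [hG]
    rw [h₁ x hx', h₂ x hx', Real.rpow_add (h.apply_pos hx), Real.rpow_one]
    push_cast
    ring
  have hG0 : G 0 = 0 := by
    simp [hG, h.map_zero, Real.zero_rpow (by linarith : α + 1 ≠ 0)]
  have key := intervalIntegral.integral_eq_sub_of_hasDerivAt_of_le (f := G) h.pos.le ?_ ?_
    (h.intervalIntegrable_rpow_mul hα
      (((continuousOn_const (c := (α : ℂ))).mul hdg |>.mul hv₁).add hc₁)
      (((hdg.mul hv₁).add (((continuousOn_const (c := (α : ℂ))).mul hdg).mul hv₂)).add hc₂))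
  · refine key.trans ?_
    rw [hG0, sub_zero, hGeq a ⟨h.pos, le_rfl⟩]
  · refine ContinuousOn.add (ContinuousOn.mul ?_ hv₁) (ContinuousOn.mul ?_ hv₂)
    · exact Complex.continuous_ofReal.comp_continuousOn
        ((continuous_rpow_mul_log (by linarith : 0 < α + 1)).comp hg hmaps)
    · exact Complex.continuous_ofReal.comp_continuousOn
        (hg.rpow_const fun x hx => Or.inr (by linarith))
  · intro x hx
    have hx' := Ioo_subset_Icc_self hx
    have hgx := h.apply_pos (Ioo_subset_Ioc_self hx)
    have d1 : HasDerivAt (fun x => ((g x ^ α : ℝ) : ℂ)) _ x :=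
      ((h.hasDerivAt hx).rpow_const (p := α) (Or.inl hgx.ne')).ofReal_comp
    have d2 : HasDerivAt (fun x => (Real.log (g x) : ℂ)) _ x :=
      ((h.hasDerivAt hx).log hgx.ne').ofReal_comp
    have d3 := d1.mul ((d2.mul (hasDerivAt_Ioo hP₁' hx)).add (hasDerivAt_Ioo hP₂' hx))
    refine (d3.congr_of_eventuallyEq ?_).congr_deriv ?_
    · filter_upwards [Ioc_mem_nhds hx.1 hx.2] with y hy using hGeq y hy
    · simp only [Pi.mul_apply, Pi.add_apply]
      rw [h₁ x hx', h₂ x hx', Real.rpow_sub hgx, Real.rpow_one]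
      have hne : (g x : ℂ) ≠ 0 := by exact_mod_cast hgx.ne'
      push_cast
      field_simp
      ring

end IsPhase

end LevinLog

/-! ### The oscillatory estimate without vanishing conditions. -/

namespace LevinLog

open MeasureTheory Filter Topology

/-- The rate `δ_α(w) w^{-min(1+α,1)}`. -/
def oscRate (α w : ℝ) : ℝ := delta α w * w ^ (-min (1 + α) 1)

theorem one_le_delta (α w : ℝ) : 1 ≤ delta α w := by
  unfold delta; split_ifs <;> simp

/-- Allows O(1) boundary terms to be absorbed into w times the rate. -/
theorem one_le_mul_oscRate {α w : ℝ} (hw : 1 ≤ w) : 1 ≤ w * oscRate α w := by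
  have hw0 : 0 < w := one_pos.trans_le hw
  have h1 : w ^ (-1 : ℝ) ≤ w ^ (-min (1 + α) 1) :=
    Real.rpow_le_rpow_of_exponent_le hw (neg_le_neg (min_le_right _ _))
  rw [Real.rpow_neg_one] at h1
  calc 1 = w * (1 * w⁻¹) := by field_simp
    _ ≤ w * oscRate α w := by
      unfold oscRate
      have := one_le_delta α w
      gcongr

/-- Near 0 the factor t raises the exponent from α - 1 to α > -1; at infinity α - 1 < -1 suffices,
which is where α < 0 enters. -/
theorem integrableOn_logWeight_mul_min {α : ℝ} (hα : -1 < α) (hα0 : α < 0) :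
    IntegrableOn (fun t => logWeight (α - 1) t * min 2 t) (Ioi 0) := by
  have hm : Measurable fun t : ℝ => logWeight (α - 1) t * min 2 t :=
    (measurable_logWeight _).mul (by fun_prop)
  rw [← Ioc_union_Ioi_eq_Ioi (zero_le_one' ℝ)]
  refine IntegrableOn.union ?_ ?_
  · refine (integrableOn_logWeight_Ioc hα 1).mono' hm.aestronglyMeasurable ?_
    filter_upwards [ae_restrict_mem measurableSet_Ioc] with t ht
    have h0 := logWeight_nonneg (α - 1) ht.1.le
    have hmin : 0 ≤ min 2 t := le_min zero_le_two ht.1.le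
    rw [Real.norm_of_nonneg (mul_nonneg h0 hmin)]
    refine (mul_le_mul_of_nonneg_left (min_le_right 2 t) h0).trans_eq ?_
    rw [logWeight, logWeight, Real.rpow_sub ht.1, Real.rpow_one]
    have := ht.1.ne'
    field_simp
  · refine ((integrableOn_logWeight_Ioi (by linarith : α - 1 < -1)).mul_const 2).mono'
      hm.aestronglyMeasurable ?_
    filter_upwards [ae_restrict_mem measurableSet_Ioi] with t ht
    have ht0 : 0 < t := one_pos.trans ht
    have h0 := logWeight_nonneg (α - 1) ht0.le
    rw [Real.norm_of_nonneg (mul_nonneg h0 (le_min zero_le_two ht0.le))]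
    exact mul_le_mul_of_nonneg_left (min_le_left 2 t) h0

/-- Since log y = log(wy) - log w, rescaling costs a factor 1 + |ln w|; this is the origin of δ_α
for negative α. -/
theorem logWeight_le_comp_mul (r : ℝ) {w y : ℝ} (hw : 0 < w) (hy : 0 < y) :
    logWeight r y ≤ w ^ (-r) * (1 + |Real.log w|) * logWeight r (w * y) := by
  unfold logWeight
  rw [Real.mul_rpow hw.le hy.le, Real.log_mul hw.ne' hy.ne', Real.rpow_neg hw.le]
  have hwr := Real.rpow_pos_of_pos hw r
  have hyr := Real.rpow_pos_of_pos hy r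
  have h1 : |Real.log y| ≤ |Real.log w| + |Real.log w + Real.log y| := by
    calc |Real.log y| = |(Real.log w + Real.log y) - Real.log w| := by ring_nf
      _ ≤ |Real.log w + Real.log y| + |Real.log w| := abs_sub _ _
      _ = _ := add_comm _ _
  calc _ ≤ y ^ r * ((1 + |Real.log w|) * (1 + |Real.log w + Real.log y|)) := by
        refine mul_le_mul_of_nonneg_left ?_ hyr.le
        nlinarith [mul_nonneg (abs_nonneg (Real.log w)) (abs_nonneg (Real.log w + Real.log y))]
    _ = _ := by field_simp

namespace IsPhase

variable {a α : ℝ} {N : ℕ} {g : ℝ → ℝ} (h : IsPhase a N g)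
include h

/-- The majorant is what integration by parts against e^{iwg} - 1 leaves behind. After y = g(x), if
α < 0 the scaling t = wy gives a convergent integral over (0,∞) times w^{-α}(1 + |ln w|), which is w
times the rate. If α > 0 the minimum is replaced by 2, the weight is integrable at 0, and the bound
is O(1). -/
theorem exists_norm_integral_le (hα : -1 < α) (hα0 : α ≠ 0) :
    ∃ C, 0 ≤ C ∧ ∀ w : ℝ, 1 ≤ w → ∀ B : ℝ, 0 ≤ B → ∀ R : ℝ → ℂ,
      (∀ x ∈ Ioc 0 a,
        ‖R x‖ ≤ B * (dg a g x * (logWeight (α - 1) (g x) * min 2 (w * g x)))) →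
      ‖∫ x in (0 : ℝ)..a, R x‖ ≤ B * C * (w * oscRate α w) := by
  have general : ∀ (w B D : ℝ) (R : ℝ → ℂ) (F : ℝ → ℝ) (s : Set ℝ), 0 ≤ B →
      (∀ x ∈ Ioc 0 a,
        ‖R x‖ ≤ B * (dg a g x * (logWeight (α - 1) (g x) * min 2 (w * g x)))) →
      MeasurableSet s → Ioc 0 (g a) ⊆ s → IntegrableOn F s → (∀ y ∈ s, 0 ≤ F y) →
      (∀ y ∈ Ioc 0 (g a), logWeight (α - 1) y * min 2 (w * y) ≤ F y) → ∫ y in s, F y ≤ D →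
      ‖∫ x in (0 : ℝ)..a, R x‖ ≤ B * D := by
    intro w B D R F s hB hR hs hs' hF hF0 hle hD
    have hi : IntervalIntegrable (fun x => B * (dg a g x * F (g x))) volume 0 a :=
      (intervalIntegrable_iff_integrableOn_Ioc_of_le h.pos.le).2
        ((h.integrableOn_dg_mul_comp (hF.mono_set hs')).const_mul B)
    refine (intervalIntegral.norm_integral_le_of_norm_le h.pos.le
      (Eventually.of_forall fun x hx => (hR x hx).trans ?_) hi).trans ?_
    · have hx' := Ioc_subset_Icc_self hx
      exact mul_le_mul_of_nonneg_left (mul_le_mul_of_nonneg_left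
        (hle _ ⟨h.apply_pos hx, h.apply_le hx'⟩) (h.dg_pos x hx').le) hB
    · rw [intervalIntegral.integral_const_mul]
      exact mul_le_mul_of_nonneg_left ((h.integral_dg_mul_comp_le hs hs' hF hF0).trans hD) hB
  rcases lt_or_gt_of_ne hα0 with hneg | hpos
  · refine ⟨∫ t in Ioi (0 : ℝ), logWeight (α - 1) t * min 2 t,
      setIntegral_nonneg measurableSet_Ioi fun t ht =>
        mul_nonneg (logWeight_nonneg _ (le_of_lt ht)) (le_min zero_le_two (le_of_lt ht)),
      fun w hw B hB R hR => ?_⟩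
    have hw0 : 0 < w := one_pos.trans_le hw
    rw [mul_assoc]
    refine general w B _ R (fun y => w ^ (-(α - 1)) * (1 + |Real.log w|) *
      (logWeight (α - 1) (w * y) * min 2 (w * y))) (Ioi 0) hB hR measurableSet_Ioi
      (fun y hy => hy.1) ?_ ?_ ?_ ?_
    · refine Integrable.const_mul ?_ _
      have := (integrableOn_Ioi_comp_mul_left_iff
        (fun t => logWeight (α - 1) t * min 2 t) 0 hw0).2
      rw [mul_zero] at this
      exact this (integrableOn_logWeight_mul_min hα hneg)
    · intro y hy
      have hy0 : 0 ≤ w * y := mul_nonneg hw0.le (le_of_lt hy)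
      exact mul_nonneg (by positivity)
        (mul_nonneg (logWeight_nonneg _ hy0) (le_min zero_le_two hy0))
    · intro y hy
      rw [← mul_assoc]
      exact mul_le_mul_of_nonneg_right (logWeight_le_comp_mul _ hw0 hy.1)
        (le_min zero_le_two (mul_nonneg hw0.le hy.1.le))
    · rw [integral_const_mul,
        integral_comp_mul_left_Ioi (fun t => logWeight (α - 1) t * min 2 t) 0 hw0, mul_zero]
      refine le_of_eq ?_
      have h1 : min (1 + α) 1 = 1 + α := min_eq_left (by linarith)
      rw [oscRate, delta, if_pos hneg.le, h1, smul_eq_mul, neg_sub, Real.rpow_sub hw0, neg_add,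
        Real.rpow_add hw0, Real.rpow_neg_one, Real.rpow_one, Real.rpow_neg hw0.le]
      field_simp
  · refine ⟨∫ y in Ioc 0 (g a), logWeight (α - 1) y * 2,
      setIntegral_nonneg measurableSet_Ioc fun t ht =>
        mul_nonneg (logWeight_nonneg _ ht.1.le) zero_le_two, fun w hw B hB R hR => ?_⟩
    have hw0 : 0 < w := one_pos.trans_le hw
    have h1 := general w B _ R (fun y => logWeight (α - 1) y * 2) (Ioc 0 (g a)) hB hR
      measurableSet_Ioc subset_rfl
      ((integrableOn_logWeight_Ioc (by linarith : -1 < α - 1) _).mul_const 2)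
      (fun y hy => mul_nonneg (logWeight_nonneg _ hy.1.le) zero_le_two)
      (fun y hy => mul_le_mul_of_nonneg_left (min_le_left _ _) (logWeight_nonneg _ hy.1.le)) le_rfl
    refine h1.trans (le_mul_of_one_le_right ?_ (one_le_mul_oscRate hw))
    exact mul_nonneg hB (setIntegral_nonneg measurableSet_Ioc fun t ht =>
        mul_nonneg (logWeight_nonneg _ ht.1.le) zero_le_two)

theorem contDiffOn_cexp (w : ℝ) : ContDiffOn ℝ ((N + 2 : ℕ) : WithTop ℕ∞)
    (fun x => Complex.exp (Complex.I * w * g x)) (Icc 0 a) :=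
  (contDiffOn_const.mul h.contDiffOn_ofReal).cexp

theorem hasDerivWithinAt_cexp (w : ℝ) {x : ℝ} (hx : x ∈ Icc 0 a) :
    HasDerivWithinAt (fun x => Complex.exp (Complex.I * w * g x))
      (Complex.I * w * dg a g x * Complex.exp (Complex.I * w * g x)) (Icc 0 a) x := by
  have := (((h.hasDerivWithinAt hx).ofReal_comp).const_mul (Complex.I * w)).cexp
  rwa [mul_comm (Complex.exp _)] at this

omit h in
theorem _root_.LevinLog.norm_cexp_I (w y : ℝ) : ‖Complex.exp (Complex.I * w * y)‖ = 1 := by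
  rw [mul_assoc, ← Complex.ofReal_mul, mul_comm, Complex.norm_exp_ofReal_mul_I]

omit h in
theorem _root_.LevinLog.norm_cexp_I_sub_one_le {w y : ℝ} (hwy : 0 ≤ w * y) :
    ‖Complex.exp (Complex.I * w * y) - 1‖ ≤ min 2 (w * y) := by
  refine le_min ?_ ?_
  · refine (norm_sub_le _ _).trans ?_
    rw [norm_cexp_I, norm_one]
    norm_num
  · rw [mul_assoc, ← Complex.ofReal_mul]
    refine (Real.norm_exp_I_mul_ofReal_sub_one_le (x := w * y)).trans ?_
    rw [Real.norm_of_nonneg hwy]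

theorem contDiffOn_inv_dg :
    ContDiffOn ℝ ((N + 1 : ℕ) : WithTop ℕ∞) (fun x => (dg a g x : ℂ)⁻¹) (Icc 0 a) :=
  h.contDiffOn_ofReal_dg.inv fun _ hx => h.ofReal_dg_ne_zero hx

/-- The weighted oscillatory integral of a fixed pair of `C¹` functions. -/
theorem exists_norm_oscillatory_le (hα : |α| < 1) (hα0 : α ≠ 0) {u v : ℝ → ℂ}
    (hu : ContDiffOn ℝ 1 u (Icc 0 a)) (hv : ContDiffOn ℝ 1 v (Icc 0 a)) :
    ∃ C, 0 ≤ C ∧ ∀ w : ℝ, 1 ≤ w →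
      ‖∫ x in (0 : ℝ)..a, ((g x ^ α : ℝ) : ℂ) * (Real.log (g x) *
        (u x * Complex.exp (Complex.I * w * g x)) + v x * Complex.exp (Complex.I * w * g x))‖
        ≤ C * oscRate α w := by
  have hα1 : -1 < α := (abs_lt.1 hα).1
  obtain ⟨K, hK0, hK⟩ := h.exists_norm_integral_le hα1 hα0
  obtain ⟨κ, hκ, hκle⟩ := h.exists_dg_lower
  have h1 : (1 : WithTop ℕ∞) ≤ ((N + 1 : ℕ) : WithTop ℕ∞) := by exact_mod_cast (by omega)
  have h2 : (1 : WithTop ℕ∞) ≤ ((N + 2 : ℕ) : WithTop ℕ∞) := by exact_mod_cast (by omega)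
  have hinv := h.contDiffOn_inv_dg.of_le h1
  have one_eq : ((0 + 1 : ℕ) : WithTop ℕ∞) = 1 := by simp
  obtain ⟨p, hp⟩ : ∃ p : ℝ → ℂ, p = fun x => u x * (dg a g x : ℂ)⁻¹ := ⟨_, rfl⟩
  obtain ⟨q, hq⟩ : ∃ q : ℝ → ℂ, q = fun x => v x * (dg a g x : ℂ)⁻¹ := ⟨_, rfl⟩
  have hpC : ContDiffOn ℝ ((0 + 1 : ℕ) : WithTop ℕ∞) p (Icc 0 a) := by
    rw [one_eq, hp]; exact hu.mul hinv
  have hqC : ContDiffOn ℝ ((0 + 1 : ℕ) : WithTop ℕ∞) q (Icc 0 a) := by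
    rw [one_eq, hq]; exact hv.mul hinv
  have hpu : ∀ x ∈ Icc 0 a, p x * dg a g x = u x := fun x hx => by
    simp [hp, h.ofReal_dg_ne_zero hx]
  have hqv : ∀ x ∈ Icc 0 a, q x * dg a g x = v x := fun x hx => by
    simp [hq, h.ofReal_dg_ne_zero hx]
  have hp'c := (contDiffOn_derivWithin_Icc h.pos hpC).continuousOn
  have hq'c := (contDiffOn_derivWithin_Icc h.pos hqC).continuousOn
  obtain ⟨D, hD0, hDp, hDq, hDp', hDq'⟩ : ∃ D : ℝ, 0 ≤ D ∧ (∀ x ∈ Icc 0 a, ‖p x‖ ≤ D) ∧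
      (∀ x ∈ Icc 0 a, ‖q x‖ ≤ D) ∧ (∀ x ∈ Icc 0 a, ‖derivWithin p (Icc 0 a) x‖ ≤ D) ∧
      (∀ x ∈ Icc 0 a, ‖derivWithin q (Icc 0 a) x‖ ≤ D) := by
    obtain ⟨D1, h1⟩ := isCompact_Icc.exists_bound_of_continuousOn hpC.continuousOn
    obtain ⟨D2, h2⟩ := isCompact_Icc.exists_bound_of_continuousOn hqC.continuousOn
    obtain ⟨D3, h3⟩ := isCompact_Icc.exists_bound_of_continuousOn hp'c
    obtain ⟨D4, h4⟩ := isCompact_Icc.exists_bound_of_continuousOn hq'c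
    have := fun x hx => (norm_nonneg _).trans (h1 x hx)
    have := fun x hx => (norm_nonneg _).trans (h2 x hx)
    have := fun x hx => (norm_nonneg _).trans (h3 x hx)
    have := fun x hx => (norm_nonneg _).trans (h4 x hx)
    have h0 := h.zero_mem
    refine ⟨D1 + D2 + D3 + D4, ?_, ?_, ?_, ?_, ?_⟩ <;> grind
  set b := g a with hb
  have hb0 : 0 < b := h.apply_pos ⟨h.pos, le_rfl⟩
  set T : ℝ := b ^ α * (|Real.log b| * (D * 2) + D * 2) with hT
  have hT0 : 0 ≤ T := by positivity
  -- T bounds the boundary term at a, using |E - 1| ≤ 2. The 2 counts the terms g'z₁ and αg'z₂ of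
  -- the part without logarithm; b/κ pays for the p' and q' terms, which carry no g' but satisfy g ≤
  -- b ≤ (b/κ) g'.
  refine ⟨T + D * (2 + b / κ) * K, by positivity, fun w hw => ?_⟩
  have hw0 : 0 < w := one_pos.trans_le hw
  set E : ℝ → ℂ := fun x => Complex.exp (Complex.I * w * g x) with hE
  have hEC : ContDiffOn ℝ 1 E (Icc 0 a) := (h.contDiffOn_cexp w).of_le h2
  have hE0 : E 0 = 1 := by simp [hE, h.map_zero]
  have hEle : ∀ x ∈ Icc 0 a, ‖E x - 1‖ ≤ min 2 (w * g x) := fun x hx =>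
    norm_cexp_I_sub_one_le (mul_nonneg hw0.le (h.apply_nonneg hx))
  -- E - 1 has the same derivative as E but vanishes at 0, so r itself need not vanish there.
  have prod : ∀ r : ℝ → ℂ, ContDiffOn ℝ ((0 + 1 : ℕ) : WithTop ℕ∞) r (Icc 0 a) →
      ContDiffOn ℝ ((0 + 1 : ℕ) : WithTop ℕ∞) (fun x => r x * (E x - 1)) (Icc 0 a) ∧
      (∀ x ∈ Icc 0 a, derivWithin (fun x => r x * (E x - 1)) (Icc 0 a) x =
        derivWithin r (Icc 0 a) x * (E x - 1) +
          Complex.I * w * (r x * dg a g x * E x)) ∧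
      ∃ z : ℝ → ℂ, ContinuousOn z (Icc 0 a) ∧ ∀ x ∈ Icc 0 a, r x * (E x - 1) = g x * z x := by
    intro r hr
    have hC : ContDiffOn ℝ ((0 + 1 : ℕ) : WithTop ℕ∞) (fun x => r x * (E x - 1)) (Icc 0 a) :=
      hr.mul ((one_eq ▸ hEC).sub contDiffOn_const)
    refine ⟨hC, fun x hx => ?_, ?_⟩
    · have := (hasDerivWithinAt_Icc hr hx).mul ((h.hasDerivWithinAt_cexp w hx).sub_const 1)
      refine (this.derivWithin (uniqueDiffOn_Icc h.pos x hx)).trans ?_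
      simp only [hE]
      ring
    · obtain ⟨z, hz, hz'⟩ := h.exists_sub_eq_mul (Nat.zero_le _) hC
      refine ⟨z, hz.continuousOn, fun x hx => ?_⟩
      rw [← hz' x hx, hE0]
      simp
  obtain ⟨hPC, hPd, z₁, hz₁, hPz⟩ := prod p hpC
  obtain ⟨hQC, hQd, z₂, hz₂, hQz⟩ := prod q hqC
  have ftc := h.integral_rpow_mul_log hα1 (by simpa using hPC) (by simpa using hQC) hz₁ hz₂ hPz hQz
  have hdg := h.contDiffOn_ofReal_dg.continuousOn
  have hEc := hEC.continuousOn
  have hE1 := hEc.sub (continuousOn_const (c := (1 : ℂ)))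
  -- The last summand is iw times the integrand to be estimated; the rest is what
  -- `exists_norm_integral_le` bounds.
  have split : ∀ x ∈ Icc 0 a, ((g x ^ α : ℝ) : ℂ) *
        (Real.log (g x) * (α * dg a g x * z₁ x
            + derivWithin (fun x => p x * (E x - 1)) (Icc 0 a) x)
          + (dg a g x * z₁ x + α * dg a g x * z₂ x
            + derivWithin (fun x => q x * (E x - 1)) (Icc 0 a) x)) =
      ((g x ^ α : ℝ) : ℂ) * (Real.log (g x) *
          (α * dg a g x * z₁ x + derivWithin p (Icc 0 a) x * (E x - 1))
        + (dg a g x * z₁ x + α * dg a g x * z₂ x + derivWithin q (Icc 0 a) x * (E x - 1)))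
      + Complex.I * w * (((g x ^ α : ℝ) : ℂ) *
          (Real.log (g x) * (u x * E x) + v x * E x)) := by
    intro x hx
    rw [hPd x hx, hQd x hx, hpu x hx, hqv x hx]
    ring
  rw [intervalIntegral.integral_congr (g := fun x => _) (fun x hx => split x (by
      rwa [uIcc_of_le h.pos.le] at hx)), intervalIntegral.integral_add,
      intervalIntegral.integral_const_mul] at ftc
  rotate_left
  · exact h.intervalIntegrable_rpow_mul hα1
      ((((continuousOn_const (c := (α : ℂ))).mul hdg).mul hz₁).add (hp'c.mul hE1))
      (((hdg.mul hz₁).add (((continuousOn_const (c := (α : ℂ))).mul hdg).mul hz₂)).add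
        (hq'c.mul hE1))
  · exact (h.intervalIntegrable_rpow_mul hα1 (hu.continuousOn.mul hEc)
      (hv.continuousOn.mul hEc)).const_mul _
  set J : ℂ := ∫ x in (0 : ℝ)..a, ((g x ^ α : ℝ) : ℂ) * (Real.log (g x) * (u x * E x) + v x * E x)
    with hJ
  have hR := hK w hw (D * (2 + b / κ)) (by positivity) (fun x => ((g x ^ α : ℝ) : ℂ) *
      (Real.log (g x) * (α * dg a g x * z₁ x + derivWithin p (Icc 0 a) x * (E x - 1))
        + (dg a g x * z₁ x + α * dg a g x * z₂ x + derivWithin q (Icc 0 a) x * (E x - 1)))) ?_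
  · have ham : a ∈ Icc 0 a := h.right_mem
    have hbd : ‖((b ^ α : ℝ) : ℂ) * (Real.log b * (p a * (E a - 1)) + q a * (E a - 1))‖ ≤ T := by
      have e2 : ‖E a - 1‖ ≤ 2 := (hEle a ham).trans (min_le_left _ _)
      rw [norm_mul, Complex.norm_real, Real.norm_of_nonneg (by positivity), hT]
      refine mul_le_mul_of_nonneg_left ((norm_add_le _ _).trans ?_) (by positivity)
      rw [norm_mul, norm_mul, norm_mul, Complex.norm_real, Real.norm_eq_abs]
      have := hDp a ham
      have := hDq a ham
      gcongr
    have hwJ : w * ‖J‖ ≤ T + D * (2 + b / κ) * K * (w * oscRate α w) := by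
      have : Complex.I * w * J = ((b ^ α : ℝ) : ℂ) *
          (Real.log b * (p a * (E a - 1)) + q a * (E a - 1)) - _ := eq_sub_of_add_eq' ftc
      calc w * ‖J‖ = ‖Complex.I * w * J‖ := by simp [abs_of_pos hw0]
        _ ≤ _ := by rw [this]; exact (norm_sub_le _ _).trans (add_le_add hbd hR)
    have hone := one_le_mul_oscRate (α := α) hw
    have : w * ‖J‖ ≤ w * ((T + D * (2 + b / κ) * K) * oscRate α w) := by
      nlinarith [mul_le_mul_of_nonneg_left hone hT0]
    exact le_of_mul_le_mul_left this hw0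
  · intro x hx
    have hx' := Ioc_subset_Icc_self hx
    have hgx := h.apply_pos hx
    set m := min 2 (w * g x) with hm
    have hm0 : 0 ≤ m := le_min zero_le_two (mul_nonneg hw0.le hgx.le)
    have hd := h.dg_pos x hx'
    have hz : ∀ (r z : ℝ → ℂ), ‖r x‖ ≤ D → r x * (E x - 1) = g x * z x →
        g x * ‖z x‖ ≤ D * m := by
      intro r z hr hrz
      have : ‖r x * (E x - 1)‖ = g x * ‖z x‖ := by
        rw [hrz, norm_mul, Complex.norm_real, Real.norm_of_nonneg hgx.le]
      rw [← this, norm_mul]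
      exact mul_le_mul hr (hEle x hx') (norm_nonneg _) hD0
    have b1 := hz p z₁ (hDp x hx') (hPz x hx')
    have b2 := hz q z₂ (hDq x hx') (hQz x hx')
    have b3 : ‖derivWithin p (Icc 0 a) x * (E x - 1)‖ ≤ D * m := by
      rw [norm_mul]; exact mul_le_mul (hDp' x hx') (hEle x hx') (norm_nonneg _) hD0
    have b4 : ‖derivWithin q (Icc 0 a) x * (E x - 1)‖ ≤ D * m := by
      rw [norm_mul]; exact mul_le_mul (hDq' x hx') (hEle x hx') (norm_nonneg _) hD0
    have hgb : g x ≤ b / κ * dg a g x := by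
      rw [div_mul_eq_mul_div, le_div_iff₀ hκ]
      exact mul_le_mul (h.apply_le hx') (hκle x hx') hκ.le hb0.le
    set ℓ := |Real.log (g x)| with hl
    have hl0 : 0 ≤ ℓ := abs_nonneg _
    set d := dg a g x with hdd
    have n1 : ‖(α * d * z₁ x : ℂ)‖ ≤ d * ‖z₁ x‖ := by
      rw [norm_mul, norm_mul, Complex.norm_real, Complex.norm_real, Real.norm_eq_abs,
        Real.norm_of_nonneg hd.le, mul_assoc]
      exact mul_le_of_le_one_left (by positivity) hα.le
    have n2 : ‖(α * d * z₂ x : ℂ)‖ ≤ d * ‖z₂ x‖ := by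
      rw [norm_mul, norm_mul, Complex.norm_real, Complex.norm_real, Real.norm_eq_abs,
        Real.norm_of_nonneg hd.le, mul_assoc]
      exact mul_le_of_le_one_left (by positivity) hα.le
    have n3 : ‖(d * z₁ x : ℂ)‖ = d * ‖z₁ x‖ := by
      rw [norm_mul, Complex.norm_real, Real.norm_of_nonneg hd.le]
    have e1 : g x * (d * ‖z₁ x‖) ≤ d * (D * m) := by
      calc _ = d * (g x * ‖z₁ x‖) := by ring
        _ ≤ _ := mul_le_mul_of_nonneg_left b1 hd.le
    have e2 : g x * (d * ‖z₂ x‖) ≤ d * (D * m) := by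
      calc _ = d * (g x * ‖z₂ x‖) := by ring
        _ ≤ _ := mul_le_mul_of_nonneg_left b2 hd.le
    have e3 : g x * (D * m) ≤ b / κ * d * (D * m) :=
      mul_le_mul_of_nonneg_right hgb (by positivity)
    have hga : (0 : ℝ) ≤ g x ^ (α - 1) := Real.rpow_nonneg hgx.le _
    have hpow : g x ^ α = g x ^ (α - 1) * g x := by
      rw [Real.rpow_sub hgx, Real.rpow_one]; field_simp
    rw [norm_mul, Complex.norm_real, Real.norm_of_nonneg (Real.rpow_nonneg hgx.le _), hpow,
      logWeight]
    calc g x ^ (α - 1) * g x * ‖Real.log (g x) * (α * d * z₁ x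
            + derivWithin p (Icc 0 a) x * (E x - 1)) + (d * z₁ x + α * d * z₂ x
            + derivWithin q (Icc 0 a) x * (E x - 1))‖
        ≤ g x ^ (α - 1) * g x * (ℓ * (d * ‖z₁ x‖ + D * m)
            + (d * ‖z₁ x‖ + d * ‖z₂ x‖ + D * m)) := by
          refine mul_le_mul_of_nonneg_left ?_ (by positivity)
          refine (norm_add_le _ _).trans (add_le_add ?_ ?_)
          · rw [norm_mul, Complex.norm_real, Real.norm_eq_abs]
            exact mul_le_mul_of_nonneg_left ((norm_add_le _ _).trans (add_le_add n1 b3)) hl0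
          · exact (norm_add_le _ _).trans (add_le_add ((norm_add_le _ _).trans
              (add_le_add n3.le n2)) b4)
      _ = g x ^ (α - 1) * (ℓ * (g x * (d * ‖z₁ x‖) + g x * (D * m))
            + (g x * (d * ‖z₁ x‖) + g x * (d * ‖z₂ x‖) + g x * (D * m))) := by ring
      _ ≤ g x ^ (α - 1) * (ℓ * (d * (D * m) + b / κ * d * (D * m))
            + (d * (D * m) + d * (D * m) + b / κ * d * (D * m))) := by gcongr
      _ ≤ g x ^ (α - 1) * (ℓ * (2 * (d * (D * m)) + b / κ * d * (D * m))
            + (d * (D * m) + d * (D * m) + b / κ * d * (D * m))) := by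
          have : 0 ≤ d * (D * m) := by positivity
          refine mul_le_mul_of_nonneg_left ?_ hga
          nlinarith [mul_nonneg hl0 this]
      _ = _ := by ring

end IsPhase

end LevinLog

/-! ### Iterated integration by parts, uniform over linear combinations. -/

namespace LevinLog

open MeasureTheory Filter Topology

/-- The linear combination `∑ i, c_i u_i` of a finite family of functions. -/
def linComb {ι : Type*} [Fintype ι] (c : ι → ℂ) (u : ι → ℝ → ℂ) (x : ℝ) : ℂ := ∑ i, c i * u i x

section LinComb

variable {ι : Type*} [Fintype ι] {a : ℝ} {c : ι → ℂ} {u v : ι → ℝ → ℂ}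

theorem contDiffOn_linComb {n : WithTop ℕ∞} (c : ι → ℂ)
    (hu : ∀ i, ContDiffOn ℝ n (u i) (Icc 0 a)) :
    ContDiffOn ℝ n (linComb c u) (Icc 0 a) :=
  ContDiffOn.sum fun i _ => contDiffOn_const.mul (hu i)

theorem hasDerivWithinAt_linComb {k : ℕ} (c : ι → ℂ)
    (hu : ∀ i, ContDiffOn ℝ ((k + 1 : ℕ) : WithTop ℕ∞) (u i) (Icc 0 a)) {x : ℝ}
    (hx : x ∈ Icc 0 a) :
    HasDerivWithinAt (linComb c u) (linComb c (fun i => derivWithin (u i) (Icc 0 a)) x)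
      (Icc 0 a) x :=
  HasDerivWithinAt.fun_sum fun i _ => (hasDerivWithinAt_Icc (hu i) hx).const_mul (c i)

theorem linComb_mul_right (c : ι → ℂ) (u : ι → ℝ → ℂ) (b : ℝ → ℂ) (x : ℝ) :
    linComb c (fun i x => u i x * b x) x = linComb c u x * b x := by
  simp only [linComb, Finset.sum_mul, mul_assoc]

end LinComb

namespace IsPhase

variable {a α : ℝ} {g : ℝ → ℝ}

/-- The weighted oscillatory integral `∫ g^α (u log g + v) e^{iwg}`. -/
def _root_.LevinLog.oscPair (a α w : ℝ) (g : ℝ → ℝ) (u v : ℝ → ℂ) : ℂ :=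
  ∫ x in (0 : ℝ)..a, ((g x ^ α : ℝ) : ℂ) * (Real.log (g x) *
    (u x * Complex.exp (Complex.I * w * g x)) + v x * Complex.exp (Complex.I * w * g x))

theorem intervalIntegrable_oscPair {N : ℕ} (h : IsPhase a N g) (hα : -1 < α) (w : ℝ) {u v : ℝ → ℂ}
    (hu : ContinuousOn u (Icc 0 a)) (hv : ContinuousOn v (Icc 0 a)) :
    IntervalIntegrable (fun x => ((g x ^ α : ℝ) : ℂ) * (Real.log (g x) *
      (u x * Complex.exp (Complex.I * w * g x)) + v x * Complex.exp (Complex.I * w * g x)))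
      volume 0 a :=
  h.intervalIntegrable_rpow_mul hα (hu.mul (h.contDiffOn_cexp w).continuousOn)
    (hv.mul (h.contDiffOn_cexp w).continuousOn)

/-- Integration by parts for `oscPair`, when `u` and `v` vanish at both end points. -/
theorem mul_oscPair_eq_neg {N : ℕ} (h : IsPhase a N g) (hα : -1 < α) (w : ℝ)
    {u v U V : ℝ → ℂ} {p' q' : ℝ → ℂ}
    (hu : ContDiffOn ℝ 1 u (Icc 0 a)) (hv : ContDiffOn ℝ 1 v (Icc 0 a))
    (hU : ContinuousOn U (Icc 0 a)) (hV : ContinuousOn V (Icc 0 a))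
    (hp'c : ContinuousOn p' (Icc 0 a)) (hq'c : ContinuousOn q' (Icc 0 a))
    (huU : ∀ x ∈ Icc 0 a, u x = g x * U x) (hvV : ∀ x ∈ Icc 0 a, v x = g x * V x)
    (hp' : ∀ x ∈ Icc 0 a,
      HasDerivWithinAt (fun x => u x * (dg a g x : ℂ)⁻¹) (p' x) (Icc 0 a) x)
    (hq' : ∀ x ∈ Icc 0 a,
      HasDerivWithinAt (fun x => v x * (dg a g x : ℂ)⁻¹) (q' x) (Icc 0 a) x)
    (hua : u a = 0) (hva : v a = 0) :
    Complex.I * w * oscPair a α w g u v =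
      -oscPair a α w g (fun x => α * U x + p' x) (fun x => α * V x + q' x + U x) := by
  have h1 : (1 : WithTop ℕ∞) ≤ ((N + 1 : ℕ) : WithTop ℕ∞) := by exact_mod_cast (by omega)
  have h2 : (1 : WithTop ℕ∞) ≤ ((N + 2 : ℕ) : WithTop ℕ∞) := by exact_mod_cast (by omega)
  have hinv := h.contDiffOn_inv_dg.of_le h1
  have hE := (h.contDiffOn_cexp w).of_le h2
  have hderiv : ∀ {r r' : ℝ → ℂ}, (∀ x ∈ Icc 0 a,
      HasDerivWithinAt (fun x => r x * (dg a g x : ℂ)⁻¹) (r' x) (Icc 0 a) x) → ∀ x ∈ Icc 0 a,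
      derivWithin (fun x => r x * (dg a g x : ℂ)⁻¹ * Complex.exp (Complex.I * w * g x))
        (Icc 0 a) x = r' x * Complex.exp (Complex.I * w * g x) +
          Complex.I * w * (r x * Complex.exp (Complex.I * w * g x)) := by
    intro r r' hr x hx
    refine (((hr x hx).mul (h.hasDerivWithinAt_cexp w hx)).derivWithin
      (uniqueDiffOn_Icc h.pos x hx)).trans ?_
    have := h.ofReal_dg_ne_zero hx
    field_simp
  have ftc := h.integral_rpow_mul_log hα ((hu.mul hinv).mul hE) ((hv.mul hinv).mul hE)
    ((hU.mul hinv.continuousOn).mul hE.continuousOn)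
    ((hV.mul hinv.continuousOn).mul hE.continuousOn)
    (fun x hx => by simp only [Pi.mul_apply]; rw [huU x hx]; ring)
    (fun x hx => by simp only [Pi.mul_apply]; rw [hvV x hx]; ring)
  simp only [hua, hva, zero_mul, mul_zero, add_zero] at ftc
  have split : ∀ x ∈ uIcc 0 a, ((g x ^ α : ℝ) : ℂ) *
        (Real.log (g x) * (α * dg a g x *
            (U x * (dg a g x : ℂ)⁻¹ * Complex.exp (Complex.I * w * g x))
          + derivWithin (fun x => u x * (dg a g x : ℂ)⁻¹ * Complex.exp (Complex.I * w * g x))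
            (Icc 0 a) x)
        + (dg a g x * (U x * (dg a g x : ℂ)⁻¹ * Complex.exp (Complex.I * w * g x))
          + α * dg a g x * (V x * (dg a g x : ℂ)⁻¹ * Complex.exp (Complex.I * w * g x))
          + derivWithin (fun x => v x * (dg a g x : ℂ)⁻¹ * Complex.exp (Complex.I * w * g x))
            (Icc 0 a) x)) =
        ((g x ^ α : ℝ) : ℂ) * (Real.log (g x) *
          ((α * U x + p' x) * Complex.exp (Complex.I * w * g x))
          + (α * V x + q' x + U x) * Complex.exp (Complex.I * w * g x))
        + Complex.I * w * (((g x ^ α : ℝ) : ℂ) * (Real.log (g x) *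
          (u x * Complex.exp (Complex.I * w * g x)) + v x * Complex.exp (Complex.I * w * g x))) := fun x hx => by
    rw [uIcc_of_le h.pos.le] at hx
    have hne := h.ofReal_dg_ne_zero hx
    rw [hderiv hp' x hx, hderiv hq' x hx]
    field_simp
    ring
  have hcα := continuousOn_const (c := (α : ℂ)) (s := Icc 0 a)
  have ftc' := (intervalIntegral.integral_congr split).symm.trans ftc
  rw [intervalIntegral.integral_add (h.intervalIntegrable_oscPair hα w
      (u := fun x => α * U x + p' x) (v := fun x => α * V x + q' x + U x)
      ((hcα.mul hU).add hp'c) (((hcα.mul hV).add hq'c).add hU))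
      ((h.intervalIntegrable_oscPair hα w hu.continuousOn hv.continuousOn).const_mul _),
    intervalIntegral.integral_const_mul] at ftc'
  exact eq_neg_of_add_eq_zero_right ftc'

/-- Each integration by parts transforms the families u and v and leaves the coefficients c
untouched, so C depends on the families alone; this is how w-dependent residuals are handled.
Vanishing is a condition on the combinations only, not on the single functions. -/
theorem exists_norm_oscPair_linComb_le (hα : |α| < 1) (hα0 : α ≠ 0) {ι : Type*} [Fintype ι]
    (k : ℕ) (h : IsPhase a k g) (u v : ι → ℝ → ℂ)
    (hu : ∀ i, ContDiffOn ℝ ((k + 1 : ℕ) : WithTop ℕ∞) (u i) (Icc 0 a))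
    (hv : ∀ i, ContDiffOn ℝ ((k + 1 : ℕ) : WithTop ℕ∞) (v i) (Icc 0 a)) :
    ∃ C, 0 ≤ C ∧ ∀ w : ℝ, 1 ≤ w → ∀ B : ℝ, ∀ c : ι → ℂ, (∀ i, ‖c i‖ ≤ B) →
      VanishesTo a k (linComb c u) 0 → VanishesTo a k (linComb c v) 0 →
      VanishesTo a k (linComb c u) a → VanishesTo a k (linComb c v) a →
      w ^ k * ‖oscPair a α w g (linComb c u) (linComb c v)‖ ≤ B * C * oscRate α w := by
  have hα1 : -1 < α := (abs_lt.1 hα).1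
  induction k generalizing u v with
  | zero =>
    have hu1 : ∀ i, ContDiffOn ℝ 1 (u i) (Icc 0 a) := fun i => by simpa using hu i
    have hv1 : ∀ i, ContDiffOn ℝ 1 (v i) (Icc 0 a) := fun i => by simpa using hv i
    choose C hC0 hC using fun i => h.exists_norm_oscillatory_le hα hα0 (hu1 i) (hv1 i)
    refine ⟨∑ i, C i, Finset.sum_nonneg fun i _ => hC0 i, fun w hw B c hc _ _ _ _ => ?_⟩
    have hsum : oscPair a α w g (linComb c u) (linComb c v) =
        ∑ i, c i * oscPair a α w g (u i) (v i) := by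
      unfold oscPair
      simp_rw [← intervalIntegral.integral_const_mul]
      rw [← intervalIntegral.integral_finsetSum fun i _ =>
        (h.intervalIntegrable_oscPair hα1 w (hu1 i).continuousOn (hv1 i).continuousOn).const_mul _]
      refine intervalIntegral.integral_congr fun x _ => ?_
      simp only [linComb, Finset.sum_mul, Finset.mul_sum, ← Finset.sum_add_distrib]
      exact Finset.sum_congr rfl fun i _ => by ring
    rw [pow_zero, one_mul, hsum, Finset.mul_sum, Finset.sum_mul]
    refine (norm_sum_le _ _).trans (Finset.sum_le_sum fun i _ => ?_)
    rw [norm_mul, mul_assoc]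
    exact mul_le_mul (hc i) (hC i w hw) (norm_nonneg _) ((norm_nonneg _).trans (hc i))
  | succ k ih =>
    have hk1 : ((k + 1 : ℕ) : WithTop ℕ∞) ≤ ((k + 1 + 1 : ℕ) : WithTop ℕ∞) := by
      exact_mod_cast (by omega)
    have h11 : (1 : WithTop ℕ∞) ≤ ((k + 1 + 1 : ℕ) : WithTop ℕ∞) := by exact_mod_cast (by omega)
    have hkk : (k : WithTop ℕ∞) ≤ ((k + 1 : ℕ) : WithTop ℕ∞) := by exact_mod_cast (by omega)
    -- A single u_i need not vanish at 0, so u_i(0) is subtracted before dividing by g. These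
    -- constants cancel in the combination (`fac`).
    choose U hU huU using fun i => h.exists_sub_eq_mul (by omega) (hu i)
    choose V hV hvV using fun i => h.exists_sub_eq_mul (by omega) (hv i)
    have hp : ∀ i, ContDiffOn ℝ ((k + 1 + 1 : ℕ) : WithTop ℕ∞)
        (fun x => u i x * (dg a g x : ℂ)⁻¹) (Icc 0 a) := fun i => (hu i).mul h.contDiffOn_inv_dg
    have hq : ∀ i, ContDiffOn ℝ ((k + 1 + 1 : ℕ) : WithTop ℕ∞)
        (fun x => v i x * (dg a g x : ℂ)⁻¹) (Icc 0 a) := fun i => (hv i).mul h.contDiffOn_inv_dg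
    have hp' := fun i => contDiffOn_derivWithin_Icc h.pos (hp i)
    have hq' := fun i => contDiffOn_derivWithin_Icc h.pos (hq i)
    set p' : ι → ℝ → ℂ := fun i => derivWithin (fun x => u i x * (dg a g x : ℂ)⁻¹) (Icc 0 a)
      with hp'def
    set q' : ι → ℝ → ℂ := fun i => derivWithin (fun x => v i x * (dg a g x : ℂ)⁻¹) (Icc 0 a)
      with hq'def
    -- The pair produced by one integration by parts; the extra U in the second slot is the
    -- derivative of log g acting on the first.
    obtain ⟨C, hC0, hC⟩ := ih (h.mono (Nat.le_succ k)) (fun i x => α * U i x + p' i x)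
      (fun i x => α * V i x + q' i x + U i x)
      (fun i => (contDiffOn_const.mul (hU i)).add (hp' i))
      (fun i => ((contDiffOn_const.mul (hV i)).add (hq' i)).add (hU i))
    refine ⟨C, hC0, fun w hw B c hc hu0 hv0 hua hva => ?_⟩
    have hw0 : 0 < w := one_pos.trans_le hw
    have hz := h.zero_mem
    have hr := h.right_mem
    have fac : ∀ (y Y : ι → ℝ → ℂ), (∀ i, ∀ x ∈ Icc 0 a, y i x - y i 0 = g x * Y i x) →
        VanishesTo a (k + 1) (linComb c y) 0 →
        ∀ x ∈ Icc 0 a, linComb c y x = g x * linComb c Y x := by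
      intro y Y hy hy0 x hx
      have e0 := hy0.apply_eq_zero
      calc linComb c y x = linComb c y x - linComb c y 0 := by rw [e0, sub_zero]
        _ = ∑ i, c i * (y i x - y i 0) := by
          simp only [linComb, mul_sub, Finset.sum_sub_distrib]
        _ = g x * linComb c Y x := by
          rw [linComb, Finset.mul_sum]
          exact Finset.sum_congr rfl fun i _ => by rw [hy i x hx]; ring
    have fu := fac u U huU hu0
    have fv := fac v V hvV hv0
    have gC : ContDiffOn ℝ ((k + 1 : ℕ) : WithTop ℕ∞) (fun x => (g x : ℂ)) (Icc 0 a) :=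
      h.contDiffOn_ofReal.of_le (by exact_mod_cast (by omega))
    have gne : (g a : ℂ) ≠ 0 := by exact_mod_cast (h.apply_pos ⟨h.pos, le_rfl⟩).ne'
    -- The division costs one order at 0, where g has a simple zero, and none at a, where g ≠ 0.
    have quot : ∀ (y Y : ι → ℝ → ℂ), (∀ i, ContDiffOn ℝ ((k + 1 : ℕ) : WithTop ℕ∞) (Y i) (Icc 0 a)) →
        (∀ x ∈ Icc 0 a, linComb c y x = g x * linComb c Y x) →
        VanishesTo a (k + 1) (linComb c y) 0 → VanishesTo a (k + 1) (linComb c y) a →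
        VanishesTo a k (linComb c Y) 0 ∧ VanishesTo a k (linComb c Y) a := by
      intro y Y hY hyY h0 ha
      have hYC := contDiffOn_linComb c hY
      refine ⟨?_, ?_⟩
      · refine (h0.congr hz hyY).of_mul_left_of_simple_zero h.pos hz (gC.of_le hkk)
          (hYC.of_le hkk) (by simp [h.map_zero]) ?_
        rw [h.derivWithin_ofReal hz]
        exact h.ofReal_dg_ne_zero hz
      · exact ((ha.congr hr hyY).of_mul_left h.pos hr gC hYC gne).mono (Nat.le_succ k)
    have der : ∀ (y : ι → ℝ → ℂ),
        (∀ i, ContDiffOn ℝ ((k + 1 + 1 : ℕ) : WithTop ℕ∞) (y i) (Icc 0 a)) → ∀ x ∈ Icc 0 a,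
        VanishesTo a (k + 1) (linComb c y) x → VanishesTo a k (linComb c fun i =>
          derivWithin (fun x => y i x * (dg a g x : ℂ)⁻¹) (Icc 0 a)) x := by
      intro y hy x hx hyx
      have hy' : ∀ i, ContDiffOn ℝ ((k + 1 + 1 : ℕ) : WithTop ℕ∞)
        (fun x => y i x * (dg a g x : ℂ)⁻¹) (Icc 0 a) := fun i => (hy i).mul h.contDiffOn_inv_dg
      have h1 : VanishesTo a (k + 1) (linComb c fun i x => y i x * (dg a g x : ℂ)⁻¹) x := by
        refine (hyx.mul_left h.pos hx (h.contDiffOn_inv_dg.of_le hk1)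
          ((contDiffOn_linComb c hy).of_le hk1)).congr hx fun t _ => ?_
        rw [linComb_mul_right, mul_comm]
      exact h1.derivWithin.congr hx fun t ht =>
        (hasDerivWithinAt_linComb c hy' ht).derivWithin (uniqueDiffOn_Icc h.pos t ht)
    have e1 : ∀ x, linComb c (fun i x => α * U i x + p' i x) x =
        α * linComb c U x + linComb c p' x := fun x => by
      simp only [linComb, Finset.mul_sum, ← Finset.sum_add_distrib]
      exact Finset.sum_congr rfl fun i _ => by ring
    have e2 : ∀ x, linComb c (fun i x => α * V i x + q' i x + U i x) x =
        α * linComb c V x + linComb c q' x + linComb c U x := fun x => by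
      simp only [linComb, Finset.mul_sum, ← Finset.sum_add_distrib]
      exact Finset.sum_congr rfl fun i _ => by ring
    have cU := (contDiffOn_linComb c hU).of_le hkk
    have cV := (contDiffOn_linComb c hV).of_le hkk
    have cp := (contDiffOn_linComb c hp').of_le hkk
    have cq := (contDiffOn_linComb c hq').of_le hkk
    have qU := quot u U hU fu hu0 hua
    have qV := quot v V hV fv hv0 hva
    have comb1 : ∀ x ∈ Icc 0 a, VanishesTo a k (linComb c U) x → VanishesTo a k (linComb c p') x →
        VanishesTo a k (linComb c fun i x => α * U i x + p' i x) x := fun x hx h1 h2 => by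
      rw [funext e1]
      exact VanishesTo.add h.pos hx (contDiffOn_const.mul cU) cp (h1.const_mul _) h2
    have comb2 : ∀ x ∈ Icc 0 a, VanishesTo a k (linComb c V) x → VanishesTo a k (linComb c q') x →
        VanishesTo a k (linComb c U) x →
        VanishesTo a k (linComb c fun i x => α * V i x + q' i x + U i x) x :=
      fun x hx h1 h2 h3 => by
      rw [funext e2]
      exact VanishesTo.add h.pos hx ((contDiffOn_const.mul cV).add cq) cU
        (VanishesTo.add h.pos hx (contDiffOn_const.mul cV) cq (h1.const_mul _) h2) h3
    have hmain := hC w hw B c hc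
      (comb1 0 hz qU.1 (der u hu 0 hz hu0)) (comb2 0 hz qV.1 (der v hv 0 hz hv0) qU.1)
      (comb1 a hr qU.2 (der u hu a hr hua)) (comb2 a hr qV.2 (der v hv a hr hva) qU.2)
    have hderU : ∀ (y : ι → ℝ → ℂ), (∀ i, ContDiffOn ℝ ((k + 1 + 1 : ℕ) : WithTop ℕ∞)
        (fun x => y i x * (dg a g x : ℂ)⁻¹) (Icc 0 a)) → ∀ x ∈ Icc 0 a,
        HasDerivWithinAt (fun x => linComb c y x * (dg a g x : ℂ)⁻¹) (linComb c (fun i =>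
          derivWithin (fun x => y i x * (dg a g x : ℂ)⁻¹) (Icc 0 a)) x) (Icc 0 a) x := by
      intro y hy x hx
      have := hasDerivWithinAt_linComb c hy hx
      rwa [funext (linComb_mul_right c y _)] at this
    have parts := h.mul_oscPair_eq_neg hα1 w ((contDiffOn_linComb c hu).of_le h11)
      ((contDiffOn_linComb c hv).of_le h11) cU.continuousOn cV.continuousOn cp.continuousOn
      cq.continuousOn fu fv (hderU u hp) (hderU v hq) hua.apply_eq_zero hva.apply_eq_zero
    rw [← funext e1, ← funext e2] at parts
    have hn : w * ‖oscPair a α w g (linComb c u) (linComb c v)‖ =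
        ‖oscPair a α w g (linComb c fun i x => α * U i x + p' i x)
          (linComb c fun i x => α * V i x + q' i x + U i x)‖ := by
      rw [← norm_neg (oscPair a α w g (linComb c fun i x => α * U i x + p' i x) _), ← parts]
      simp [abs_of_pos hw0]
    rw [pow_succ, mul_assoc, hn]
    exact hmain

end IsPhase

end LevinLog

/-! ### The integral and the Levin rule as weighted oscillatory integrals. -/

namespace LevinLog

open MeasureTheory Filter Topology

namespace IsPhase

variable {a α w : ℝ} {N k : ℕ} {g : ℝ → ℝ} (h : IsPhase a N g)
include h

/-- With g = xγ this function is f γ^{-α} on all of [0,a], so the singularity at 0 is only apparent.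
In the same way `logPart` is -f log γ. -/
theorem contDiffOn_algPart (hk : k ≤ N + 1) {f : ℝ → ℂ}
    (hf : ContDiffOn ℝ (k : WithTop ℕ∞) f (Icc 0 a)) :
    ContDiffOn ℝ (k : WithTop ℕ∞) (algPart a α g f) (Icc 0 a) := by
  obtain ⟨γ, hγ, hg, hpos, h0⟩ := h.exists_eq_mul
  have h1 : ContDiffOn ℝ (k : WithTop ℕ∞) (fun x => ((γ x ^ (-α) : ℝ) : ℂ)) (Icc 0 a) :=
    Complex.ofRealCLM.contDiff.comp_contDiffOn
      ((hγ.of_le (by exact_mod_cast hk)).rpow_const_of_ne fun x hx => (hpos x hx).ne')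
  refine (hf.mul h1).congr fun x hx => ?_
  have hγ0 := (hpos x hx).le
  unfold algPart
  split_ifs with hx0
  · rw [hx0, ← h0, Real.rpow_neg (hpos 0 h.zero_mem).le, div_eq_mul_inv, Complex.ofReal_inv]
  · have : x / g x = (γ x)⁻¹ := by
      rw [hg x hx, div_mul_eq_div_div, div_self hx0, one_div]
    rw [this, Real.inv_rpow hγ0, Real.rpow_neg hγ0]

theorem contDiffOn_logPart (hk : k ≤ N + 1) {f : ℝ → ℂ}
    (hf : ContDiffOn ℝ (k : WithTop ℕ∞) f (Icc 0 a)) :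
    ContDiffOn ℝ (k : WithTop ℕ∞) (logPart a g f) (Icc 0 a) := by
  obtain ⟨γ, hγ, hg, hpos, h0⟩ := h.exists_eq_mul
  have h1 : ContDiffOn ℝ (k : WithTop ℕ∞) (fun x => ((-Real.log (γ x) : ℝ) : ℂ)) (Icc 0 a) :=
    Complex.ofRealCLM.contDiff.comp_contDiffOn
      ((hγ.of_le (by exact_mod_cast hk)).log fun x hx => (hpos x hx).ne').neg
  refine (hf.mul h1).congr fun x hx => ?_
  unfold logPart
  split_ifs with hx0
  · rw [hx0, ← h0, one_div, Real.log_inv]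
  · have : x / g x = (γ x)⁻¹ := by
      rw [hg x hx, div_mul_eq_div_div, div_self hx0, one_div]
    rw [this, Real.log_inv]

omit h in
theorem _root_.LevinLog.oscPair_congr (ha : 0 ≤ a) {u u' v v' : ℝ → ℂ} (hu : EqOn u u' (Icc 0 a))
    (hv : EqOn v v' (Icc 0 a)) : oscPair a α w g u v = oscPair a α w g u' v' :=
  intervalIntegral.integral_congr fun x hx => by
    rw [uIcc_of_le ha] at hx
    simp only [hu hx, hv hx]

theorem oscPair_add (hα : -1 < α) {u u' v v' : ℝ → ℂ} (hu : ContinuousOn u (Icc 0 a))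
    (hv : ContinuousOn v (Icc 0 a)) (hu' : ContinuousOn u' (Icc 0 a))
    (hv' : ContinuousOn v' (Icc 0 a)) :
    oscPair a α w g (fun x => u x + u' x) (fun x => v x + v' x) =
      oscPair a α w g u v + oscPair a α w g u' v' := by
  unfold oscPair
  rw [← intervalIntegral.integral_add (h.intervalIntegrable_oscPair hα w hu hv)
    (h.intervalIntegrable_oscPair hα w hu' hv')]
  exact intervalIntegral.integral_congr fun x _ => by ring

theorem oscPair_sub (hα : -1 < α) {u u' v v' : ℝ → ℂ} (hu : ContinuousOn u (Icc 0 a))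
    (hv : ContinuousOn v (Icc 0 a)) (hu' : ContinuousOn u' (Icc 0 a))
    (hv' : ContinuousOn v' (Icc 0 a)) :
    oscPair a α w g (fun x => u x - u' x) (fun x => v x - v' x) =
      oscPair a α w g u v - oscPair a α w g u' v' := by
  unfold oscPair
  rw [← intervalIntegral.integral_sub (h.intervalIntegrable_oscPair hα w hu hv)
    (h.intervalIntegrable_oscPair hα w hu' hv')]
  exact intervalIntegral.integral_congr fun x _ => by ring

/-- Splits log x = log g + log(x/g) and x^α = g^α (x/g)^α. -/
theorem oscIntegral_eq_oscPair (f : ℝ → ℂ) : oscIntegral a α w g f =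
    oscPair a α w g (algPart a α g f) (algPart a α g (logPart a g f)) := by
  refine intervalIntegral.integral_congr_ae (Eventually.of_forall fun x hx => ?_)
  rw [uIoc_of_le h.pos.le] at hx
  have hx0 : x ≠ 0 := hx.1.ne'
  have hg := h.apply_pos hx
  have hpow : g x ^ α * (x / g x) ^ α = x ^ α := by
    rw [Real.div_rpow hx.1.le hg.le]
    have := (Real.rpow_pos_of_pos hg α).ne'
    field_simp
  simp only [algPart, logPart, if_neg hx0]
  rw [← hpow, Real.log_div hx0 hg.ne']
  push_cast
  ring

theorem continuousOn_WOp {q : ℝ → ℂ} (hq : ContDiffOn ℝ 1 q (Icc 0 a)) (c₀ : ℂ) :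
    ContinuousOn (WOp a α w g c₀ q) (Icc 0 a) := by
  have hq' : ContDiffOn ℝ ((0 + 1 : ℕ) : WithTop ℕ∞) q (Icc 0 a) := by simpa using hq
  have h1 := (contDiffOn_derivWithin_Icc h.pos hq').continuousOn
  have h2 := hq.continuousOn
  have h3 := h.contDiffOn_ofReal_dg.continuousOn
  have h4 := h.contDiffOn_ofReal.continuousOn
  unfold WOp
  fun_prop

/-- The Levin antiderivative: `primLog` is a primitive of the collocated integrand. -/
theorem primLog_sub_primLog (hα : -1 < α) {q ℓ : ℝ → ℂ}
    (hq : ContDiffOn ℝ 1 q (Icc 0 a)) (hℓ : ContDiffOn ℝ 1 ℓ (Icc 0 a)) (c₀ d₀ : ℂ) :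
    primLog a α w g c₀ d₀ q ℓ a - primLog a α w g c₀ d₀ q ℓ 0 =
      oscPair a α w g (WOp a α w g c₀ q)
        (fun x => WOp a α w g d₀ ℓ x + q x * dg a g x) := by
  have h2 : (1 : WithTop ℕ∞) ≤ ((N + 2 : ℕ) : WithTop ℕ∞) := by exact_mod_cast (by omega)
  set E : ℝ → ℂ := fun x => Complex.exp (Complex.I * w * g x) with hE
  have hEC : ContDiffOn ℝ 1 E (Icc 0 a) := (h.contDiffOn_cexp w).of_le h2
  have hE0 : E 0 = 1 := by simp [hE, h.map_zero]
  have one_eq : ((0 + 1 : ℕ) : WithTop ℕ∞) = 1 := by simp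
  have gC := h.contDiffOn_ofReal.of_le h2
  obtain ⟨z, hz, hz'⟩ := h.exists_sub_eq_mul (Nat.zero_le _) (one_eq ▸ hEC)
  rw [hE0] at hz'
  have hzc := hz.continuousOn
  have hEc := hEC.continuousOn
  have hqc := hq.continuousOn
  have hℓc := hℓ.continuousOn
  have hdg := h.contDiffOn_ofReal_dg.continuousOn
  -- This is the explicit part of the rule times e^{iwg}, with g^α and the logarithm removed. It
  -- vanishes at 0, as the fundamental theorem requires.
  have prod : ∀ (b : ℂ) (r : ℝ → ℂ), ContDiffOn ℝ 1 r (Icc 0 a) →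
      ContDiffOn ℝ 1 (fun x => g x * r x * E x + b * (E x - 1)) (Icc 0 a) ∧
      ContinuousOn (fun x => r x * E x + b * z x) (Icc 0 a) ∧
      (∀ x ∈ Icc 0 a, g x * r x * E x + b * (E x - 1) = g x * (r x * E x + b * z x)) ∧
      ∀ x ∈ Icc 0 a, derivWithin (fun x => g x * r x * E x + b * (E x - 1)) (Icc 0 a) x =
        (dg a g x * r x + g x * derivWithin r (Icc 0 a) x) * E x +
          (g x * r x + b) * (Complex.I * w * dg a g x * E x) := by
    intro b r hr
    have hrc := hr.continuousOn
    refine ⟨((gC.mul hr).mul hEC).add (contDiffOn_const.mul (hEC.sub contDiffOn_const)),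
      (hrc.mul hEc).add (continuousOn_const.mul hzc), fun x hx => ?_, fun x hx => ?_⟩
    · rw [hz' x hx]; ring
    · have hr' : ContDiffOn ℝ ((0 + 1 : ℕ) : WithTop ℕ∞) r (Icc 0 a) := one_eq ▸ hr
      have d1 := ((h.hasDerivWithinAt hx).ofReal_comp.mul (hasDerivWithinAt_Icc hr' hx)).mul
        (h.hasDerivWithinAt_cexp w hx)
      have d2 := d1.add (((h.hasDerivWithinAt_cexp w hx).sub_const 1).const_mul b)
      refine (d2.derivWithin (uniqueDiffOn_Icc h.pos x hx)).trans ?_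
      simp only [hE, Pi.mul_apply]
      ring
  obtain ⟨hPC, hPc, hPz, hPd⟩ := prod c₀ q hq
  obtain ⟨hQC, hQc, hQz, hQd⟩ := prod d₀ ℓ hℓ
  have ftc := h.integral_rpow_mul_log hα hPC hQC hPc hQc hPz hQz
  -- Differentiating g^α against c₀(E - 1) and d₀(E - 1), and log g against c₀(E - 1), leaves terms
  -- absent from 𝒲; the integral in `hLog` cancels exactly these.
  set H : ℝ → ℂ := fun t => (α * c₀ * Real.log (g t) + α * d₀ + c₀) *
        (dg a g t * (1 - Complex.exp (Complex.I * w * g t)) / ((g t ^ (1 - α) : ℝ) : ℂ)) with hH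
  have hHeq : ∀ x ∈ Ioc 0 a, H x = ((g x ^ α : ℝ) : ℂ) * (Real.log (g x) *
      (-(α * c₀ * dg a g x * z x)) + -((α * d₀ + c₀) * dg a g x * z x)) := by
    intro x hx
    have hx' := Ioc_subset_Icc_self hx
    have hgx := h.apply_pos hx
    have hne : (g x : ℂ) ≠ 0 := by exact_mod_cast hgx.ne'
    have hpne : ((g x ^ α : ℝ) : ℂ) ≠ 0 := by
      exact_mod_cast (Real.rpow_pos_of_pos hgx α).ne'
    have e1 : 1 - Complex.exp (Complex.I * w * g x) = -(g x * z x) := by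
      rw [← hz' x hx']; ring
    simp only [hH]
    rw [e1, Real.rpow_sub hgx, Real.rpow_one]
    push_cast
    field_simp
    ring
  have hHi : IntervalIntegrable (fun x => ((g x ^ α : ℝ) : ℂ) * (Real.log (g x) *
      (-(α * c₀ * dg a g x * z x)) + -((α * d₀ + c₀) * dg a g x * z x))) volume 0 a :=
    h.intervalIntegrable_rpow_mul hα (A := fun x => -(α * c₀ * dg a g x * z x))
      (B := fun x => -((α * d₀ + c₀) * dg a g x * z x)) (by fun_prop) (by fun_prop)
  have hHint : ∫ x in (0 : ℝ)..a, H x = ∫ x in (0 : ℝ)..a, ((g x ^ α : ℝ) : ℂ) *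
      (Real.log (g x) * (-(α * c₀ * dg a g x * z x)) + -((α * d₀ + c₀) * dg a g x * z x)) :=
    intervalIntegral.integral_congr_ae (Eventually.of_forall fun x hx => hHeq x (by
      rwa [uIoc_of_le h.pos.le] at hx))
  have hW := h.continuousOn_WOp (α := α) (w := w) hq c₀
  have hW' : ContinuousOn (fun x => WOp a α w g d₀ ℓ x + q x * dg a g x) (Icc 0 a) :=
    (h.continuousOn_WOp (α := α) (w := w) hℓ d₀).add (hqc.mul hdg)
  have hOi := h.intervalIntegrable_oscPair hα w hW hW'
  have split : ∀ x ∈ uIcc 0 a, ((g x ^ α : ℝ) : ℂ) *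
      (Real.log (g x) * (α * dg a g x * (q x * E x + c₀ * z x)
          + derivWithin (fun x => g x * q x * E x + c₀ * (E x - 1)) (Icc 0 a) x)
        + (dg a g x * (q x * E x + c₀ * z x) + α * dg a g x * (ℓ x * E x + d₀ * z x)
          + derivWithin (fun x => g x * ℓ x * E x + d₀ * (E x - 1)) (Icc 0 a) x)) =
      ((g x ^ α : ℝ) : ℂ) * (Real.log (g x) * (WOp a α w g c₀ q x * E x)
        + (WOp a α w g d₀ ℓ x + q x * dg a g x) * E x)
      - ((g x ^ α : ℝ) : ℂ) * (Real.log (g x) *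
      (-(α * c₀ * dg a g x * z x)) + -((α * d₀ + c₀) * dg a g x * z x)) := fun x hx => by
    rw [uIcc_of_le h.pos.le] at hx
    rw [hPd x hx, hQd x hx]
    unfold WOp
    ring
  rw [intervalIntegral.integral_congr split, intervalIntegral.integral_sub hOi hHi, ← hHint] at ftc
  have hosc : oscPair a α w g (WOp a α w g c₀ q)
      (fun x => WOp a α w g d₀ ℓ x + q x * dg a g x) = ∫ x in (0 : ℝ)..a,
      ((g x ^ α : ℝ) : ℂ) * (Real.log (g x) * (WOp a α w g c₀ q x * E x)
        + (WOp a α w g d₀ ℓ x + q x * dg a g x) * E x) := rfl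
  rw [hosc, sub_eq_iff_eq_add.1 ftc]
  have p0 : primLog a α w g c₀ d₀ q ℓ 0 = 0 := by
    simp [primLog, hLog, h.map_zero, Real.zero_rpow (by linarith : 1 + α ≠ 0)]
  have hgpos := h.apply_pos ⟨h.pos, le_rfl⟩
  have hEa : Complex.exp (-(Complex.I * w * g a)) * E a = 1 := by
    rw [← Complex.exp_add, neg_add_cancel, Complex.exp_zero]
  rw [p0, sub_zero, primLog, hLog, Real.rpow_add hgpos, Real.rpow_one]
  push_cast
  change _ * E a = _
  linear_combination ((∫ x in (0 : ℝ)..a, H x) - (c₀ * Real.log (g a) + d₀) *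
    ((g a ^ α : ℝ) : ℂ)) * hEa

/-- The logarithmic primitive with c₀ = 0 and q = 0. -/
theorem primAlg_sub_primAlg (hα : -1 < α) {r : ℝ → ℂ}
    (hr : ContDiffOn ℝ 1 r (Icc 0 a)) (e₀ : ℂ) :
    primAlg a α w g e₀ r a - primAlg a α w g e₀ r 0 =
      oscPair a α w g (fun _ => 0) (WOp a α w g e₀ r) := by
  have key := h.primLog_sub_primLog hα (q := fun _ => 0) (w := w) contDiffOn_const hr 0 e₀
  have e : ∀ x, primLog a α w g 0 e₀ (fun _ => 0) r x = primAlg a α w g e₀ r x := fun x => by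
    simp only [primLog, primAlg, hLog, hAlg, mul_zero, zero_mul, zero_add, add_zero,
      intervalIntegral.integral_const_mul]
    rw [add_comm α 1]
    ring
  rw [e, e] at key
  rw [key]
  refine oscPair_congr h.pos.le (fun x _ => ?_) fun x _ => ?_
  · simp [WOp]
  · simp

theorem levinLog_eq_oscPair (hα : -1 < α) {M : ℕ} {φ : Fin M → ℝ → ℂ}
    (hφ : ∀ i, ContDiffOn ℝ 1 (φ i) (Icc 0 a)) (e c d : ℂ × (Fin M → ℂ)) :
    levinLog a α w g φ e c d = oscPair a α w g (WOp a α w g c.1 (comb φ c.2)) (fun x =>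
      WOp a α w g e.1 (comb φ e.2) x +
        (WOp a α w g d.1 (comb φ d.2) x + comb φ c.2 x * dg a g x)) := by
  have hC : ∀ b : Fin M → ℂ, ContDiffOn ℝ 1 (comb φ b) (Icc 0 a) := fun b =>
    contDiffOn_linComb b hφ
  rw [levinLog, levinAlg, h.primAlg_sub_primAlg hα (hC _),
    h.primLog_sub_primLog hα (hC _) (hC _)]
  refine (h.oscPair_add hα continuousOn_const (h.continuousOn_WOp (hC _) _)
    (h.continuousOn_WOp (hC _) _) ((h.continuousOn_WOp (hC _) _).add
      ((hC _).continuousOn.mul h.contDiffOn_ofReal_dg.continuousOn))).symm.trans ?_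
  exact oscPair_congr h.pos.le (fun x _ => zero_add _) fun x _ => rfl

end IsPhase

end LevinLog

/-! ### Perturbed linear systems, jets, and the splitting of 𝒲 in powers of w. -/

namespace LevinLog

/-- Solvability and stability of a linear system `i w A + B` with injective `A`, for large `w`. -/
theorem exists_forall_bijective_smul_add {X Y : Type*} [NormedAddCommGroup X] [NormedSpace ℂ X]
    [FiniteDimensional ℂ X] [NormedAddCommGroup Y] [NormedSpace ℂ Y] [FiniteDimensional ℂ Y]
    (hdim : Module.finrank ℂ X = Module.finrank ℂ Y) (A B : X →ₗ[ℂ] Y)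
    (hA : Function.Injective A) :
    ∃ C w₀ : ℝ, 0 ≤ C ∧ 1 ≤ w₀ ∧ ∀ w : ℝ, w₀ ≤ w →
      Function.Bijective ((Complex.I * w) • A + B) ∧
      ∀ c, w * ‖c‖ ≤ C * ‖((Complex.I * w) • A + B) c‖ := by
  obtain ⟨K, hK0, hK⟩ := A.exists_antilipschitzWith (LinearMap.ker_eq_bot.2 hA)
  set β := ‖LinearMap.toContinuousLinearMap B‖ with hβ
  have hβ0 : 0 ≤ β := norm_nonneg _
  have hAK : ∀ c, ‖c‖ ≤ K * ‖A c‖ := fun c => by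
    simpa using hK.le_mul_dist c 0
  have hB : ∀ c, ‖B c‖ ≤ β * ‖c‖ := fun c => (LinearMap.toContinuousLinearMap B).le_opNorm c
  have hKr : (0 : ℝ) < K := hK0
  -- Beyond this threshold Kβ‖c‖ ≤ w‖c‖/2, so the contribution of B is absorbed on the left at the
  -- price of the factor 2.
  have bound : ∀ w : ℝ, 1 + 2 * K * β ≤ w → ∀ c,
      w * ‖c‖ ≤ 2 * K * ‖((Complex.I * w) • A + B) c‖ := by
    intro w hw c
    have hw0 : 0 < w := by nlinarith [mul_nonneg hKr.le hβ0]
    have h1 : w * ‖A c‖ ≤ ‖((Complex.I * w) • A + B) c‖ + β * ‖c‖ := by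
      calc w * ‖A c‖ = ‖(Complex.I * w) • A c‖ := by simp [norm_smul, abs_of_pos hw0]
        _ = ‖((Complex.I * w) • A + B) c - B c‖ := by simp
        _ ≤ _ := (norm_sub_le _ _).trans (add_le_add le_rfl (hB c))
    have h2 : w * ‖c‖ ≤ K * (w * ‖A c‖) := by
      calc w * ‖c‖ ≤ w * (K * ‖A c‖) := mul_le_mul_of_nonneg_left (hAK c) hw0.le
        _ = _ := by ring
    have h3 := mul_le_mul_of_nonneg_left h1 hKr.le
    have h4 := mul_le_mul_of_nonneg_right hw (norm_nonneg c)
    nlinarith [norm_nonneg c]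
  refine ⟨2 * K, 1 + 2 * K * β, by positivity, by nlinarith [mul_nonneg hKr.le hβ0],
    fun w hw => ⟨?_, bound w hw⟩⟩
  have hw0 : 0 < w := by nlinarith [mul_nonneg hKr.le hβ0]
  have hinj : Function.Injective ((Complex.I * w) • A + B) := by
    rw [← LinearMap.ker_eq_bot, LinearMap.ker_eq_bot']
    intro c hc
    have := bound w hw c
    rw [hc, norm_zero, mul_zero] at this
    have : ‖c‖ ≤ 0 := by
      by_contra! h
      nlinarith [mul_pos hw0 h]
    simpa using this
  exact ⟨hinj, (LinearMap.injective_iff_surjective_of_finrank_eq_finrank hdim).1 hinj⟩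

/-- The derivatives of `u` prescribed in a Hermite interpolation problem. -/
def jets {n : ℕ} (a : ℝ) (x : Fin (n + 1) → ℝ) (m : Fin (n + 1) → ℕ) (u : ℝ → ℂ) :
    (Σ l, Fin (m l)) → ℂ := fun s => iteratedDerivWithin s.2 u (Icc 0 a) (x s.1)

/-- The coefficients of a collocation solution as a family indexed by `Option (Fin M)`. -/
def coeffs (M : ℕ) : ℂ × (Fin M → ℂ) →ₗ[ℂ] (Option (Fin M) → ℂ) where
  toFun c o := o.elim c.1 c.2
  map_add' c d := by ext (_ | i) <;> rfl
  map_smul' r c := by ext (_ | i) <;> rfl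

theorem norm_coeffs_le {M : ℕ} (c : ℂ × (Fin M → ℂ)) (o : Option (Fin M)) :
    ‖coeffs M c o‖ ≤ ‖c‖ := by
  rcases o with _ | i
  · exact norm_fst_le c
  · exact (norm_le_pi_norm c.2 i).trans (norm_snd_le c)

section Jets

variable {n : ℕ} {a : ℝ} {x : Fin (n + 1) → ℝ} {m : Fin (n + 1) → ℕ}

theorem le_maxMult (l : Fin (n + 1)) : m l ≤ maxMult m := Finset.le_sup (Finset.mem_univ l)

theorem jets_eq_zero_iff {u : ℝ → ℂ} :
    jets a x m u = 0 ↔ ∀ l, VanishesTo a (m l) u (x l) := by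
  refine ⟨fun h l j hj => congr_fun h ⟨l, j, hj⟩, fun h => ?_⟩
  ext ⟨l, j⟩
  exact h l j j.2

theorem jets_congr (hx : ∀ l, x l ∈ Icc 0 a) {u v : ℝ → ℂ} (huv : EqOn u v (Icc 0 a)) :
    jets a x m u = jets a x m v := by
  ext s
  exact iteratedDerivWithin_congr huv (hx s.1)

theorem jets_linComb (ha : 0 < a) (hx : ∀ l, x l ∈ Icc 0 a) {ι : Type*} [Fintype ι] (c : ι → ℂ)
    {u : ι → ℝ → ℂ}
    (hu : ∀ i, ContDiffOn ℝ (maxMult m : WithTop ℕ∞) (u i) (Icc 0 a)) :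
    jets a x m (linComb c u) = Fintype.linearCombination ℂ (fun i => jets a x m (u i)) c := by
  ext ⟨l, j⟩
  have hj : ((j : ℕ) : WithTop ℕ∞) ≤ (maxMult m : WithTop ℕ∞) := by
    exact_mod_cast j.2.le.trans (le_maxMult l)
  have := iteratedDerivWithin_fun_sum (I := Finset.univ) (n := (j : ℕ))
    (f := fun i y => c i * u i y) (hx l) (uniqueDiffOn_Icc ha)
    (fun i _ => (contDiffOn_const.mul ((hu i).of_le hj)) _ (hx l))
  simp only [iteratedDerivWithin_const_mul_field] at this
  simpa [jets, Fintype.linearCombination_apply, linComb] using! this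

end Jets

/-- The functions multiplied by `i w` in `𝒲`. -/
def leadFam {M : ℕ} (a : ℝ) (g : ℝ → ℝ) (φ : Fin M → ℝ → ℂ) : Option (Fin M) → ℝ → ℂ
  | none => fun x => dg a g x
  | some i => fun x => g x * dg a g x * φ i x

/-- The functions in `𝒲` which do not carry the factor `i w`. -/
def lowFam {M : ℕ} (a α : ℝ) (g : ℝ → ℝ) (φ : Fin M → ℝ → ℂ) : Option (Fin M) → ℝ → ℂ
  | none => fun _ => 0
  | some i => fun x => g x * derivWithin (φ i) (Icc 0 a) x + (1 + α) * dg a g x * φ i x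

/-- The functions `φ_i g'`. -/
def dgFam {M : ℕ} (a : ℝ) (g : ℝ → ℝ) (φ : Fin M → ℝ → ℂ) : Option (Fin M) → ℝ → ℂ
  | none => fun _ => 0
  | some i => fun x => φ i x * dg a g x

namespace IsPhase

variable {a α w : ℝ} {N : ℕ} {g : ℝ → ℝ} {M : ℕ} {φ : Fin M → ℝ → ℂ} (h : IsPhase a N g)
include h

theorem contDiffOn_leadFam
    (hφ : ∀ i, ContDiffOn ℝ ((N + 2 : ℕ) : WithTop ℕ∞) (φ i) (Icc 0 a)) (o : Option (Fin M)) :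
    ContDiffOn ℝ ((N + 1 : ℕ) : WithTop ℕ∞) (leadFam a g φ o) (Icc 0 a) := by
  have h12 : ((N + 1 : ℕ) : WithTop ℕ∞) ≤ ((N + 2 : ℕ) : WithTop ℕ∞) := by
    exact_mod_cast (by omega)
  rcases o with _ | i
  · exact h.contDiffOn_ofReal_dg
  · exact ((h.contDiffOn_ofReal.of_le h12).mul h.contDiffOn_ofReal_dg).mul ((hφ i).of_le h12)

theorem contDiffOn_lowFam
    (hφ : ∀ i, ContDiffOn ℝ ((N + 2 : ℕ) : WithTop ℕ∞) (φ i) (Icc 0 a)) (o : Option (Fin M)) :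
    ContDiffOn ℝ ((N + 1 : ℕ) : WithTop ℕ∞) (lowFam a α g φ o) (Icc 0 a) := by
  have h12 : ((N + 1 : ℕ) : WithTop ℕ∞) ≤ ((N + 2 : ℕ) : WithTop ℕ∞) := by
    exact_mod_cast (by omega)
  rcases o with _ | i
  · exact contDiffOn_const
  · exact ((h.contDiffOn_ofReal.of_le h12).mul (contDiffOn_derivWithin_Icc h.pos (hφ i))).add
      ((contDiffOn_const.mul h.contDiffOn_ofReal_dg).mul ((hφ i).of_le h12))

theorem contDiffOn_dgFam
    (hφ : ∀ i, ContDiffOn ℝ ((N + 2 : ℕ) : WithTop ℕ∞) (φ i) (Icc 0 a)) (o : Option (Fin M)) :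
    ContDiffOn ℝ ((N + 1 : ℕ) : WithTop ℕ∞) (dgFam a g φ o) (Icc 0 a) := by
  have h12 : ((N + 1 : ℕ) : WithTop ℕ∞) ≤ ((N + 2 : ℕ) : WithTop ℕ∞) := by
    exact_mod_cast (by omega)
  rcases o with _ | i
  · exact contDiffOn_const
  · exact ((hφ i).of_le h12).mul h.contDiffOn_ofReal_dg

omit h in
theorem _root_.LevinLog.linComb_leadFam (c : ℂ × (Fin M → ℂ)) (x : ℝ) :
    linComb (coeffs M c) (leadFam a g φ) x = dg a g x * (c.1 + g x * comb φ c.2 x) := by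
  simp only [linComb, Fintype.sum_option, leadFam, coeffs, comb, LinearMap.coe_mk, AddHom.coe_mk,
    Option.elim, mul_add, Finset.mul_sum]
  congr 1
  · ring
  · exact Finset.sum_congr rfl fun i _ => by ring

omit h in
theorem _root_.LevinLog.linComb_dgFam (c : ℂ × (Fin M → ℂ)) (x : ℝ) :
    linComb (coeffs M c) (dgFam a g φ) x = comb φ c.2 x * dg a g x := by
  simp only [linComb, Fintype.sum_option, dgFam, coeffs, comb, LinearMap.coe_mk, AddHom.coe_mk,
    Option.elim, Finset.sum_mul, mul_zero, zero_add]
  exact Finset.sum_congr rfl fun i _ => by ring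

/-- Isolates the dependence on w: the two families are fixed and w occurs only as an explicit
factor. -/
theorem WOp_eq_linComb
    (hφ : ∀ i, ContDiffOn ℝ ((N + 2 : ℕ) : WithTop ℕ∞) (φ i) (Icc 0 a))
    (c : ℂ × (Fin M → ℂ)) {x : ℝ} (hx : x ∈ Icc 0 a) :
    WOp a α w g c.1 (comb φ c.2) x = Complex.I * w * linComb (coeffs M c) (leadFam a g φ) x
      + linComb (coeffs M c) (lowFam a α g φ) x := by
  have hd : derivWithin (comb φ c.2) (Icc 0 a) x = ∑ i, c.2 i * derivWithin (φ i) (Icc 0 a) x :=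
    (hasDerivWithinAt_linComb (k := N + 1) c.2 hφ hx).derivWithin (uniqueDiffOn_Icc h.pos x hx)
  rw [linComb_leadFam, WOp, hd]
  simp only [linComb, Fintype.sum_option, lowFam, coeffs, LinearMap.coe_mk, AddHom.coe_mk,
    Option.elim, mul_zero, zero_add, mul_add, Finset.sum_add_distrib]
  have e1 : ∑ i, c.2 i * (g x * derivWithin (φ i) (Icc 0 a) x) =
      g x * ∑ i, c.2 i * derivWithin (φ i) (Icc 0 a) x := by
    rw [Finset.mul_sum]; exact Finset.sum_congr rfl fun i _ => by ring
  have e2 : ∑ i, c.2 i * ((1 + α) * dg a g x * φ i x) = (1 + α) * dg a g x * comb φ c.2 x := by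
    rw [comb, Finset.mul_sum]; exact Finset.sum_congr rfl fun i _ => by ring
  rw [e1, e2]
  ring

end IsPhase

end LevinLog

/-! ### Unisolvence and the collocation matrix. -/

namespace LevinLog

/-- Hermite interpolation by `c₀ + g q`, `q` in the span of a Chebyshev set, is unique. -/
theorem IsPhase.eq_zero_of_jets_eq_zero {n M s : ℕ} {a : ℝ} {x : Fin (n + 1) → ℝ}
    {m : Fin (n + 1) → ℕ} {g : ℝ → ℝ} {φ : Fin M → ℝ → ℂ} (h : IsPhase a (maxMult m) g)
    (hinj : Function.Injective x) (hx : ∀ l, x l ∈ Icc 0 a) (hx₀ : x 0 = 0) (hm₀ : m 0 = s + 1)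
    (hM : ∑ l, m l = M + 1)
    (hφ : ∀ i, ContDiffOn ℝ ((maxMult m + 2 : ℕ) : WithTop ℕ∞) (φ i) (Icc 0 a))
    (hcheb : IsChebyshevSet a (maxMult m) φ) (c : ℂ × (Fin M → ℂ))
    (hc : jets a x m (linComb (coeffs M c) (leadFam a g φ)) = 0) : c = 0 := by
  set μ := maxMult m with hμ
  have hz := h.zero_mem
  have hle : ∀ {k : ℕ}, k ≤ μ → (k : WithTop ℕ∞) ≤ ((μ + 2 : ℕ) : WithTop ℕ∞) := fun hk => by
    exact_mod_cast (by omega)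
  have hle1 : ∀ {k : ℕ}, k ≤ μ → (k : WithTop ℕ∞) ≤ ((μ + 1 : ℕ) : WithTop ℕ∞) := fun hk => by
    exact_mod_cast (by omega)
  have hq : ContDiffOn ℝ ((μ + 2 : ℕ) : WithTop ℕ∞) (comb φ c.2) (Icc 0 a) :=
    contDiffOn_linComb c.2 hφ
  have h1 : ∀ l, VanishesTo a (m l) (fun y => c.1 + g y * comb φ c.2 y) (x l) := fun l => by
    have h0 := jets_eq_zero_iff.1 hc l
    rw [funext (linComb_leadFam c)] at h0
    exact h0.of_mul_left h.pos (hx l) (h.contDiffOn_ofReal_dg.of_le (hle1 (le_maxMult l)))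
      ((contDiffOn_const.add (h.contDiffOn_ofReal.mul hq)).of_le (hle (le_maxMult l)))
      (h.ofReal_dg_ne_zero (hx l))
  -- At the node 0 the factor g removes q.
  have hc1 : c.1 = 0 := by
    have h0 := h1 0
    rw [hm₀, hx₀] at h0
    simpa [h.map_zero] using h0.apply_eq_zero
  have h2 : ∀ l, VanishesTo a (m l) (fun y => g y * comb φ c.2 y) (x l) := fun l => by
    simpa [hc1] using h1 l
  have hc2 : c.2 = 0 := by
    -- The node 0 has multiplicity s + 1, but the simple zero of g uses up one order, so q vanishes
    -- only to order s there. The total is (M + 1) - 1 = M, as the Chebyshev property demands.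
    set k : ℝ → ℕ := Function.extend x (fun l => if l = 0 then s else m l) 0 with hk
    have hkx : ∀ l, k (x l) = if l = 0 then s else m l := fun l => hinj.extend_apply _ _ l
    refine hcheb (Finset.univ.image x) k ?_ ?_ c.2 ?_
    · intro z hz
      obtain ⟨l, -, rfl⟩ := Finset.mem_image.1 hz
      refine ⟨hx l, ?_⟩
      rw [hkx]
      split_ifs with hl
      · have := le_maxMult (m := m) 0
        omega
      · exact le_maxMult l
    · rw [Finset.sum_image fun l _ l' _ hll' => hinj hll']
      simp only [hkx]
      rw [Fin.sum_univ_succ] at hM ⊢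
      simp only [if_true, Fin.succ_ne_zero, if_false]
      omega
    · intro z hz'
      obtain ⟨l, -, rfl⟩ := Finset.mem_image.1 hz'
      rw [hkx]
      by_cases hl : l = 0
      · subst hl
        have h0 := h2 0
        have hs : s ≤ μ := by have := le_maxMult (m := m) 0; omega
        rw [hm₀, hx₀] at h0
        rw [if_pos rfl, hx₀]
        refine h0.of_mul_left_of_simple_zero h.pos hz (h.contDiffOn_ofReal.of_le (hle hs))
          (hq.of_le (hle hs)) (by simp [h.map_zero]) ?_
        rw [h.derivWithin_ofReal hz]
        exact h.ofReal_dg_ne_zero hz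
      · rw [if_neg hl]
        refine (h2 l).of_mul_left h.pos (hx l) (h.contDiffOn_ofReal.of_le (hle (le_maxMult l)))
          (hq.of_le (hle (le_maxMult l))) ?_
        have hne : x l ≠ 0 := fun h0 => hl (hinj (h0.trans hx₀.symm))
        exact_mod_cast (h.apply_pos ⟨lt_of_le_of_ne (hx l).1 hne.symm, (hx l).2⟩).ne'
  exact Prod.ext hc1 hc2

section Collocation

variable {n M : ℕ} {a α w : ℝ} {x : Fin (n + 1) → ℝ} {m : Fin (n + 1) → ℕ} {g : ℝ → ℝ}
  {φ : Fin M → ℝ → ℂ}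

/-- The linear map `c ↦ ∑ c_o jets (u_o)`. -/
def jetMap (a : ℝ) (x : Fin (n + 1) → ℝ) (m : Fin (n + 1) → ℕ) (u : Option (Fin M) → ℝ → ℂ) :
    ℂ × (Fin M → ℂ) →ₗ[ℂ] ((Σ l, Fin (m l)) → ℂ) :=
  Fintype.linearCombination ℂ (fun o => jets a x m (u o)) ∘ₗ coeffs M

theorem jets_linComb_coeffs (ha : 0 < a) (hx : ∀ l, x l ∈ Icc 0 a)
    {u : Option (Fin M) → ℝ → ℂ}
    (hu : ∀ o, ContDiffOn ℝ ((maxMult m + 1 : ℕ) : WithTop ℕ∞) (u o) (Icc 0 a))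
    (c : ℂ × (Fin M → ℂ)) : jets a x m (linComb (coeffs M c) u) = jetMap a x m u c :=
  jets_linComb ha hx _ fun o => (hu o).of_le (by exact_mod_cast (by omega))

theorem jets_add (ha : 0 < a) (hx : ∀ l, x l ∈ Icc 0 a) {u v : ℝ → ℂ}
    (hu : ContDiffOn ℝ ((maxMult m + 1 : ℕ) : WithTop ℕ∞) u (Icc 0 a))
    (hv : ContDiffOn ℝ ((maxMult m + 1 : ℕ) : WithTop ℕ∞) v (Icc 0 a)) (b c : ℂ) :
    jets a x m (fun y => b * u y + c * v y) = b • jets a x m u + c • jets a x m v := by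
  have hle : (maxMult m : WithTop ℕ∞) ≤ ((maxMult m + 1 : ℕ) : WithTop ℕ∞) := by
    exact_mod_cast (by omega)
  have := jets_linComb (m := m) ha hx ![b, c] (u := ![u, v]) (fun i => by
    fin_cases i
    · exact hu.of_le hle
    · exact hv.of_le hle)
  rw [Fintype.linearCombination_apply, Fin.sum_univ_two] at this
  rw [← jets_congr hx (fun y _ => ?_)]
  · exact this
  · simp [linComb, Fin.sum_univ_two]

/-- The collocation matrix. -/
def colMap (a α w : ℝ) (g : ℝ → ℝ) (φ : Fin M → ℝ → ℂ) (x : Fin (n + 1) → ℝ)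
    (m : Fin (n + 1) → ℕ) : ℂ × (Fin M → ℂ) →ₗ[ℂ] ((Σ l, Fin (m l)) → ℂ) :=
  (Complex.I * w) • jetMap a x m (leadFam a g φ) + jetMap a x m (lowFam a α g φ)

theorem IsPhase.contDiffOn_WOp {N : ℕ} (h : IsPhase a N g)
    (hφ : ∀ i, ContDiffOn ℝ ((N + 2 : ℕ) : WithTop ℕ∞) (φ i) (Icc 0 a)) (c : ℂ × (Fin M → ℂ)) :
    ContDiffOn ℝ ((N + 1 : ℕ) : WithTop ℕ∞) (WOp a α w g c.1 (comb φ c.2)) (Icc 0 a) :=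
  ((contDiffOn_const.mul (contDiffOn_linComb (coeffs M c) (h.contDiffOn_leadFam hφ))).add
    (contDiffOn_linComb (coeffs M c) (h.contDiffOn_lowFam (α := α) hφ))).congr
    fun _ hy => h.WOp_eq_linComb hφ c hy

theorem IsPhase.WOp_add {N : ℕ} (h : IsPhase a N g)
    (hφ : ∀ i, ContDiffOn ℝ ((N + 2 : ℕ) : WithTop ℕ∞) (φ i) (Icc 0 a)) (c d : ℂ × (Fin M → ℂ))
    {y : ℝ} (hy : y ∈ Icc 0 a) :
    WOp a α w g (c + d).1 (comb φ (c + d).2) y =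
      WOp a α w g c.1 (comb φ c.2) y + WOp a α w g d.1 (comb φ d.2) y := by
  simp only [h.WOp_eq_linComb hφ _ hy, map_add, linComb, Pi.add_apply, add_mul,
    Finset.sum_add_distrib]
  ring

theorem IsPhase.jets_WOp (h : IsPhase a (maxMult m) g) (hx : ∀ l, x l ∈ Icc 0 a)
    (hφ : ∀ i, ContDiffOn ℝ ((maxMult m + 2 : ℕ) : WithTop ℕ∞) (φ i) (Icc 0 a))
    (c : ℂ × (Fin M → ℂ)) :
    jets a x m (WOp a α w g c.1 (comb φ c.2)) = colMap a α w g φ x m c := by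
  have hl := h.contDiffOn_leadFam hφ
  have hlow := h.contDiffOn_lowFam (α := α) hφ
  rw [jets_congr hx (fun y hy => h.WOp_eq_linComb hφ c hy)]
  have := jets_add h.pos hx (contDiffOn_linComb (coeffs M c) hl)
    (contDiffOn_linComb (coeffs M c) hlow) (Complex.I * w) 1
  simp only [one_mul, one_smul] at this
  rw [this, jets_linComb_coeffs h.pos hx hl, jets_linComb_coeffs h.pos hx hlow]
  rfl

theorem IsPhase.jets_comb_mul_dg (h : IsPhase a (maxMult m) g) (hx : ∀ l, x l ∈ Icc 0 a)
    (hφ : ∀ i, ContDiffOn ℝ ((maxMult m + 2 : ℕ) : WithTop ℕ∞) (φ i) (Icc 0 a))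
    (c : ℂ × (Fin M → ℂ)) :
    jets a x m (fun y => comb φ c.2 y * dg a g y) = jetMap a x m (dgFam a g φ) c := by
  rw [← jets_linComb_coeffs h.pos hx (h.contDiffOn_dgFam hφ), funext (linComb_dgFam c)]

theorem jets_neg (u : ℝ → ℂ) : jets a x m (fun y => -u y) = -jets a x m u := by
  ext s
  simp [jets, iteratedDerivWithin_fun_neg]

theorem IsPhase.solvesCollocation_iff (h : IsPhase a (maxMult m) g) (hx : ∀ l, x l ∈ Icc 0 a)
    (hφ : ∀ i, ContDiffOn ℝ ((maxMult m + 2 : ℕ) : WithTop ℕ∞) (φ i) (Icc 0 a)) {F : ℝ → ℂ}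
    {c : ℂ × (Fin M → ℂ)} :
    SolvesCollocation a α w g φ x m F c ↔ colMap a α w g φ x m c = jets a x m F := by
  rw [← h.jets_WOp hx hφ]
  refine ⟨fun hs => ?_, fun hs l j hj => congr_fun hs ⟨l, j, hj⟩⟩
  ext ⟨l, j⟩
  exact hs l j j.2

end Collocation

theorem linComb_sumElim {ι κ : Type*} [Fintype ι] [Fintype κ] (c : ι → ℂ) (d : κ → ℂ)
    (u : ι → ℝ → ℂ) (v : κ → ℝ → ℂ) (x : ℝ) :
    linComb (Sum.elim c d) (Sum.elim u v) x = linComb c u x + linComb d v x := by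
  simp [linComb, Fintype.sum_sum_type]

theorem linComb_smul {ι : Type*} [Fintype ι] (r : ℂ) (c : ι → ℂ) (u : ι → ℝ → ℂ) (x : ℝ) :
    linComb (r • c) u x = r * linComb c u x := by
  simp [linComb, Finset.mul_sum, mul_assoc]

end LevinLog

/-! ### The collocation residuals and the error bound. -/

namespace LevinLog

/-- The error of the Levin rule is the oscillatory integral of the two collocation residuals. -/
theorem IsPhase.oscIntegral_sub_levinLog {N M : ℕ} {a α w : ℝ} {g : ℝ → ℝ} {f : ℝ → ℂ}
    {φ : Fin M → ℝ → ℂ} (h : IsPhase a N g) (hα : -1 < α)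
    (hf : ContDiffOn ℝ ((N + 1 : ℕ) : WithTop ℕ∞) f (Icc 0 a))
    (hφ : ∀ i, ContDiffOn ℝ ((N + 2 : ℕ) : WithTop ℕ∞) (φ i) (Icc 0 a))
    (c d e : ℂ × (Fin M → ℂ)) :
    oscIntegral a α w g f - levinLog a α w g φ e c d =
      oscPair a α w g (fun x => algPart a α g f x - WOp a α w g c.1 (comb φ c.2) x)
        (fun x => algPart a α g (logPart a g f) x - (WOp a α w g e.1 (comb φ e.2) x +
          (WOp a α w g d.1 (comb φ d.2) x + comb φ c.2 x * dg a g x))) := by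
  have h1 : (1 : WithTop ℕ∞) ≤ ((N + 2 : ℕ) : WithTop ℕ∞) := by exact_mod_cast (by omega)
  have hφ1 := fun i => (hφ i).of_le h1
  have hC : ∀ b : Fin M → ℂ, ContDiffOn ℝ 1 (comb φ b) (Icc 0 a) := fun b =>
    contDiffOn_linComb b hφ1
  rw [h.oscIntegral_eq_oscPair, h.levinLog_eq_oscPair hα hφ1]
  exact (h.oscPair_sub hα (h.contDiffOn_algPart le_rfl hf).continuousOn
    (h.contDiffOn_algPart le_rfl (h.contDiffOn_logPart le_rfl hf)).continuousOn
    (h.continuousOn_WOp (hC _) _) ((h.continuousOn_WOp (hC _) _).add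
      ((h.continuousOn_WOp (hC _) _).add
        ((hC _).continuousOn.mul h.contDiffOn_ofReal_dg.continuousOn)))).symm

section Residual

variable {M : ℕ}

/-- The functions spanning the first residual (and `0` for those of the second). -/
def residualFam₁ (a α : ℝ) (g : ℝ → ℝ) (φ : Fin M → ℝ → ℂ) (F : ℝ → ℂ) :
    Unit ⊕ ((Option (Fin M) ⊕ Option (Fin M)) ⊕ (Option (Fin M) ⊕ Option (Fin M))) → ℝ → ℂ :=
  Sum.elim (fun _ => F) (Sum.elim (Sum.elim (leadFam a g φ) (lowFam a α g φ))
    (Sum.elim (fun _ _ => 0) (fun _ _ => 0)))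

/-- The functions spanning the second residual (and `0` for those of the first). -/
def residualFam₂ (a α : ℝ) (g : ℝ → ℝ) (φ : Fin M → ℝ → ℂ) (F : ℝ → ℂ) :
    Unit ⊕ ((Option (Fin M) ⊕ Option (Fin M)) ⊕ (Option (Fin M) ⊕ Option (Fin M))) → ℝ → ℂ :=
  Sum.elim (fun _ => F) (Sum.elim (Sum.elim (fun _ _ => 0) (dgFam a g φ))
    (Sum.elim (leadFam a g φ) (lowFam a α g φ)))

/-- The coefficients of the two residuals. -/
def residualCoeffs (w : ℝ) (c d : ℂ × (Fin M → ℂ)) :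
    Unit ⊕ ((Option (Fin M) ⊕ Option (Fin M)) ⊕ (Option (Fin M) ⊕ Option (Fin M))) → ℂ :=
  Sum.elim (fun _ => 1) (Sum.elim
    (Sum.elim ((-(Complex.I * w)) • coeffs M c) ((-1 : ℂ) • coeffs M c))
    (Sum.elim ((-(Complex.I * w)) • coeffs M d) ((-1 : ℂ) • coeffs M d)))

/-- The bound on w‖c‖ serves the coefficients carrying iw; those without w follow from w ≥ 1. -/
theorem norm_residualCoeffs_le {w B : ℝ} (hw : 1 ≤ w) {c d : ℂ × (Fin M → ℂ)} (hB : 1 ≤ B)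
    (hc : w * ‖c‖ ≤ B) (hd : w * ‖d‖ ≤ B) (i) : ‖residualCoeffs w c d i‖ ≤ B := by
  have hw0 : 0 < w := one_pos.trans_le hw
  have lead : ∀ e : ℂ × (Fin M → ℂ), w * ‖e‖ ≤ B → ∀ o,
      ‖((-(Complex.I * w)) • coeffs M e) o‖ ≤ B := fun e he o => by
    refine le_trans ?_ he
    simpa [abs_of_pos hw0] using mul_le_mul_of_nonneg_left (norm_coeffs_le e o) hw0.le
  have low : ∀ e : ℂ × (Fin M → ℂ), w * ‖e‖ ≤ B → ∀ o,
      ‖((-1 : ℂ) • coeffs M e) o‖ ≤ B := fun e he o => by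
    have h1 : ‖e‖ ≤ w * ‖e‖ := le_mul_of_one_le_left (norm_nonneg e) hw
    simpa using (norm_coeffs_le e o).trans (h1.trans he)
  rcases i with _ | (o | o) | (o | o)
  · simpa [residualCoeffs] using hB
  · exact lead c hc o
  · exact low c hc o
  · exact lead d hd o
  · exact low d hd o

end Residual

namespace IsPhase

variable {n M s : ℕ} {a α w : ℝ} {x : Fin (n + 1) → ℝ} {m : Fin (n + 1) → ℕ} {g : ℝ → ℝ}
  {φ : Fin M → ℝ → ℂ}

theorem linComb_residual₁ {N : ℕ} (h : IsPhase a N g)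
    (hφ : ∀ i, ContDiffOn ℝ ((N + 2 : ℕ) : WithTop ℕ∞) (φ i) (Icc 0 a)) (F : ℝ → ℂ)
    (c d : ℂ × (Fin M → ℂ)) {y : ℝ} (hy : y ∈ Icc 0 a) :
    linComb (residualCoeffs w c d) (residualFam₁ a α g φ F) y =
      F y - WOp a α w g c.1 (comb φ c.2) y := by
  rw [h.WOp_eq_linComb hφ c hy, residualCoeffs, residualFam₁]
  simp only [linComb_sumElim, linComb_smul]
  simp only [linComb, mul_zero, Finset.sum_const_zero, Fintype.sum_unique]
  ring

/-- The slot with coefficients -c holds the functions φ_i g' and so yields -qg'. The zero entries of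
the two families let one coefficient vector serve both residuals, as
`exists_norm_oscPair_linComb_le` demands. -/
theorem linComb_residual₂ {N : ℕ} (h : IsPhase a N g)
    (hφ : ∀ i, ContDiffOn ℝ ((N + 2 : ℕ) : WithTop ℕ∞) (φ i) (Icc 0 a)) (F : ℝ → ℂ)
    (c d : ℂ × (Fin M → ℂ)) {y : ℝ} (hy : y ∈ Icc 0 a) :
    linComb (residualCoeffs w c d) (residualFam₂ a α g φ F) y =
      F y - (WOp a α w g d.1 (comb φ d.2) y + comb φ c.2 y * dg a g y) := by
  rw [h.WOp_eq_linComb hφ d hy, ← linComb_dgFam, residualCoeffs, residualFam₂]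
  simp only [linComb_sumElim, linComb_smul]
  simp only [linComb, mul_zero, Finset.sum_const_zero, Fintype.sum_unique]
  ring

theorem contDiffOn_residualFam₁ {N : ℕ} (h : IsPhase a N g)
    (hφ : ∀ i, ContDiffOn ℝ ((N + 2 : ℕ) : WithTop ℕ∞) (φ i) (Icc 0 a)) {F : ℝ → ℂ}
    (hF : ContDiffOn ℝ ((N + 1 : ℕ) : WithTop ℕ∞) F (Icc 0 a)) (i) :
    ContDiffOn ℝ ((N + 1 : ℕ) : WithTop ℕ∞) (residualFam₁ a α g φ F i) (Icc 0 a) := by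
  rcases i with _ | (o | o) | (o | o)
  · exact hF
  · exact h.contDiffOn_leadFam hφ o
  · exact h.contDiffOn_lowFam hφ o
  · exact contDiffOn_const
  · exact contDiffOn_const

theorem contDiffOn_residualFam₂ {N : ℕ} (h : IsPhase a N g)
    (hφ : ∀ i, ContDiffOn ℝ ((N + 2 : ℕ) : WithTop ℕ∞) (φ i) (Icc 0 a)) {F : ℝ → ℂ}
    (hF : ContDiffOn ℝ ((N + 1 : ℕ) : WithTop ℕ∞) F (Icc 0 a)) (i) :
    ContDiffOn ℝ ((N + 1 : ℕ) : WithTop ℕ∞) (residualFam₂ a α g φ F i) (Icc 0 a) := by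
  rcases i with _ | (o | o) | (o | o)
  · exact hF
  · exact contDiffOn_const
  · exact h.contDiffOn_dgFam hφ o
  · exact h.contDiffOn_leadFam hφ o
  · exact h.contDiffOn_lowFam hφ o

theorem jets_residual₁ (h : IsPhase a (maxMult m) g) (hx : ∀ l, x l ∈ Icc 0 a)
    (hφ : ∀ i, ContDiffOn ℝ ((maxMult m + 2 : ℕ) : WithTop ℕ∞) (φ i) (Icc 0 a)) {F : ℝ → ℂ}
    (hF : ContDiffOn ℝ ((maxMult m + 1 : ℕ) : WithTop ℕ∞) F (Icc 0 a)) (c : ℂ × (Fin M → ℂ)) :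
    jets a x m (fun y => F y - WOp a α w g c.1 (comb φ c.2) y) =
      jets a x m F - colMap a α w g φ x m c := by
  have := jets_add (m := m) h.pos hx hF (h.contDiffOn_WOp (α := α) (w := w) hφ c) 1 (-1)
  rw [h.jets_WOp hx hφ, one_smul, neg_one_smul, ← sub_eq_add_neg] at this
  simpa only [one_mul, neg_one_mul, ← sub_eq_add_neg] using this

theorem jets_residual₂ (h : IsPhase a (maxMult m) g) (hx : ∀ l, x l ∈ Icc 0 a)
    (hφ : ∀ i, ContDiffOn ℝ ((maxMult m + 2 : ℕ) : WithTop ℕ∞) (φ i) (Icc 0 a)) {F : ℝ → ℂ}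
    (hF : ContDiffOn ℝ ((maxMult m + 1 : ℕ) : WithTop ℕ∞) F (Icc 0 a)) (c d : ℂ × (Fin M → ℂ)) :
    jets a x m
        (fun y => F y - (WOp a α w g d.1 (comb φ d.2) y + comb φ c.2 y * dg a g y)) =
      jets a x m F - (colMap a α w g φ x m d + jetMap a x m (dgFam a g φ) c) := by
  have hW := h.contDiffOn_WOp (α := α) (w := w) hφ d
  have hq : ContDiffOn ℝ ((maxMult m + 1 : ℕ) : WithTop ℕ∞)
      (fun y => comb φ c.2 y * dg a g y) (Icc 0 a) := by
    rw [← funext (linComb_dgFam c)]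
    exact contDiffOn_linComb _ (h.contDiffOn_dgFam hφ)
  have h1 := jets_add (m := m) h.pos hx hW hq 1 1
  have h2 := jets_add (m := m) h.pos hx hF (hW.add hq) 1 (-1)
  rw [h.jets_WOp hx hφ, h.jets_comb_mul_dg hx hφ, one_smul, one_smul] at h1
  simp only [one_mul] at h1
  simp only [one_mul, neg_one_mul, ← sub_eq_add_neg, one_smul, neg_one_smul] at h2
  rw [← h1]
  exact h2

/-- The error of the Levin rule, in terms of bounds for the collocation solutions. -/
theorem exists_norm_oscIntegral_sub_levinLog_le (h : IsPhase a (maxMult m) g)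
    (hα : |α| < 1) (hα0 : α ≠ 0) (hx : ∀ l, x l ∈ Icc 0 a) (hx₀ : x 0 = 0)
    (hxn : x (Fin.last n) = a) (hm₀ : m 0 = s + 1) (hmn : m (Fin.last n) = s + 1) {f : ℝ → ℂ}
    (hf : ContDiffOn ℝ ((maxMult m + 1 : ℕ) : WithTop ℕ∞) f (Icc 0 a))
    (hφ : ∀ i, ContDiffOn ℝ ((maxMult m + 2 : ℕ) : WithTop ℕ∞) (φ i) (Icc 0 a)) :
    ∃ C, 0 ≤ C ∧ ∀ w : ℝ, 1 ≤ w → ∀ B : ℝ, 1 ≤ B → ∀ c d e : ℂ × (Fin M → ℂ),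
      colMap a α w g φ x m c = jets a x m (algPart a α g f) →
      colMap a α w g φ x m d = -jetMap a x m (dgFam a g φ) c →
      colMap a α w g φ x m e = jets a x m (algPart a α g (logPart a g f)) →
      w * ‖c‖ ≤ B → w * ‖d + e‖ ≤ B →
      w ^ (s + 1) * ‖oscIntegral a α w g f - levinLog a α w g φ e c d‖ ≤ B * C * oscRate α w := by
  have hs : s + 1 ≤ maxMult m := hm₀ ▸ le_maxMult 0
  have hF₁ := h.contDiffOn_algPart (α := α) le_rfl hf
  have hF₂ := h.contDiffOn_algPart (α := α) le_rfl (h.contDiffOn_logPart le_rfl hf)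
  -- s + 1 integrations by parts need C^{s+2} functions; C^{μ+1} is enough because s + 1 ≤ μ.
  have hle : ((s + 1 + 1 : ℕ) : WithTop ℕ∞) ≤ ((maxMult m + 1 : ℕ) : WithTop ℕ∞) := by
    exact_mod_cast (by omega)
  obtain ⟨C, hC0, hC⟩ := exists_norm_oscPair_linComb_le hα hα0 (s + 1) (h.mono hs)
    (residualFam₁ a α g φ (algPart a α g f))
    (residualFam₂ a α g φ (algPart a α g (logPart a g f)))
    (fun i => (h.contDiffOn_residualFam₁ hφ hF₁ i).of_le hle)
    (fun i => (h.contDiffOn_residualFam₂ hφ hF₂ i).of_le hle)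
  refine ⟨C, hC0, fun w hw B hB c d e hc hd he hcB hdB => ?_⟩
  have r₁ : EqOn (fun y => algPart a α g f y - WOp a α w g c.1 (comb φ c.2) y)
      (linComb (residualCoeffs w c (d + e)) (residualFam₁ a α g φ (algPart a α g f)))
      (Icc 0 a) := fun y hy => (h.linComb_residual₁ hφ _ c (d + e) hy).symm
  -- The solutions d and e enter the second residual only through their sum, 𝒲 being additive in the
  -- coefficients.
  have r₂ : EqOn (fun y => algPart a α g (logPart a g f) y -
        (WOp a α w g (d + e).1 (comb φ (d + e).2) y + comb φ c.2 y * dg a g y))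
      (linComb (residualCoeffs w c (d + e))
        (residualFam₂ a α g φ (algPart a α g (logPart a g f)))) (Icc 0 a) :=
    fun y hy => (h.linComb_residual₂ hφ _ c (d + e) hy).symm
  have v₁ := jets_eq_zero_iff.1 ((h.jets_residual₁ (α := α) (w := w) hx hφ hF₁ c).trans
    (by rw [hc, sub_self]))
  have v₂ := jets_eq_zero_iff.1 ((h.jets_residual₂ (α := α) (w := w) hx hφ hF₂ c (d + e)).trans
    (by rw [map_add, hd, he]; abel))
  have v₁' := fun l => (v₁ l).congr (hx l) r₁
  have v₂' := fun l => (v₂ l).congr (hx l) r₂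
  -- Only the end nodes are used here; the interior conditions serve solvability.
  have key := hC w hw B _ (norm_residualCoeffs_le hw hB hcB hdB)
    (by simpa [hx₀, hm₀] using v₁' 0) (by simpa [hx₀, hm₀] using v₂' 0)
    (by simpa [hxn, hmn] using v₁' (Fin.last n)) (by simpa [hxn, hmn] using v₂' (Fin.last n))
  rw [h.oscIntegral_sub_levinLog (abs_lt.1 hα).1 hf hφ, oscPair_congr h.pos.le r₁ fun y hy => ?_]
  · exact key
  · rw [← r₂ hy]
    simp only []
    rw [h.WOp_add hφ d e hy]
    ring

end IsPhase

end LevinLog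

end

/-! ### Assembly of the main theorem. -/

theorem theorem3p1
    (a α : ℝ) (ha : 0 < a) (hα₀ : 0 < |α|) (hα₁ : |α| < 1)
    (n M s : ℕ) (x : Fin (n + 1) → ℝ) (m : Fin (n + 1) → ℕ)
    (hx : StrictMono x) (hx₀ : x 0 = 0) (hxn : x (Fin.last n) = a)
    (hm : ∀ l, 1 ≤ m l) (hm₀ : m 0 = s + 1) (hmn : m (Fin.last n) = s + 1)
    (hM : ∑ l, m l = M + 1)
    (f : ℝ → ℂ) (g : ℝ → ℝ) (φ : Fin M → ℝ → ℂ)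
    (hf : ContDiffOn ℝ ((LevinLog.maxMult m + 1 : ℕ) : WithTop ℕ∞) f (Icc 0 a))
    (hg : ContDiffOn ℝ ((LevinLog.maxMult m + 2 : ℕ) : WithTop ℕ∞) g (Icc 0 a))
    (hφ : ∀ i, ContDiffOn ℝ ((LevinLog.maxMult m + 2 : ℕ) : WithTop ℕ∞) (φ i) (Icc 0 a))
    (hg₀ : g 0 = 0) (hg' : ∀ t ∈ Icc 0 a, 0 < LevinLog.dg a g t)
    (hcheb : LevinLog.IsChebyshevSet a (LevinLog.maxMult m) φ) :
    ∃ C w₀ : ℝ, 0 < w₀ ∧ ∀ w : ℝ, w₀ ≤ w →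
      (∃! c, LevinLog.SolvesCollocation a α w g φ x m (LevinLog.algPart a α g f) c) ∧
      (∀ c, LevinLog.SolvesCollocation a α w g φ x m (LevinLog.algPart a α g f) c →
        ∃! d, LevinLog.SolvesCollocation a α w g φ x m
          (fun t => -(LevinLog.comb φ c.2 t * LevinLog.dg a g t)) d) ∧
      (∃! e, LevinLog.SolvesCollocation a α w g φ x m
        (LevinLog.algPart a α g (LevinLog.logPart a g f)) e) ∧
      (∀ c d e,
        LevinLog.SolvesCollocation a α w g φ x m (LevinLog.algPart a α g f) c →
        LevinLog.SolvesCollocation a α w g φ x m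
          (fun t => -(LevinLog.comb φ c.2 t * LevinLog.dg a g t)) d →
        LevinLog.SolvesCollocation a α w g φ x m
          (LevinLog.algPart a α g (LevinLog.logPart a g f)) e →
        ‖LevinLog.oscIntegral a α w g f - LevinLog.levinLog a α w g φ e c d‖
          ≤ C * LevinLog.delta α w * w ^ (-(s : ℝ) - 1 - min (1 + α) 1)) := by
  open LevinLog in
  have h : IsPhase a (maxMult m) g := ⟨ha, hg, hg₀, hg'⟩
  have hxI : ∀ l, x l ∈ Icc 0 a := fun l =>
    ⟨hx₀ ▸ hx.monotone (Fin.zero_le l), hxn ▸ hx.monotone (Fin.le_last l)⟩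
  have hα0 : α ≠ 0 := abs_pos.1 hα₀
  -- There are ∑ m_l = M + 1 conditions for the M + 1 unknowns.
  have hdim : Module.finrank ℂ (ℂ × (Fin M → ℂ)) =
      Module.finrank ℂ ((Σ l, Fin (m l)) → ℂ) := by
    simp [hM, add_comm]
  have hinj : Function.Injective (jetMap a x m (leadFam a g φ)) := by
    rw [← LinearMap.ker_eq_bot, LinearMap.ker_eq_bot']
    intro c hc
    rw [← jets_linComb_coeffs ha hxI (h.contDiffOn_leadFam hφ)] at hc
    exact h.eq_zero_of_jets_eq_zero hx.injective hxI hx₀ hm₀ hM hφ hcheb c hc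
  obtain ⟨K, w₀, hK0, hw₀, hK⟩ := exists_forall_bijective_smul_add hdim
    (jetMap a x m (leadFam a g φ)) (jetMap a x m (lowFam a α g φ)) hinj
  obtain ⟨C, hC0, hC⟩ := h.exists_norm_oscIntegral_sub_levinLog_le hα₁ hα0 hxI hx₀ hxn hm₀ hmn
    hf hφ
  set y₁ := jets a x m (algPart a α g f)
  set y₂ := jets a x m (algPart a α g (logPart a g f))
  set β := ‖LinearMap.toContinuousLinearMap (jetMap a x m (dgFam a g φ))‖
  have hβ : ∀ c, ‖jetMap a x m (dgFam a g φ) c‖ ≤ β * ‖c‖ := fun c =>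
    (LinearMap.toContinuousLinearMap (jetMap a x m (dgFam a g φ))).le_opNorm c
  have hβ0 : 0 ≤ β := norm_nonneg _
  -- The 1 covers the coefficient of the data functions; the other terms bound w‖c‖, w‖d‖ and w‖e‖.
  -- The bound for d uses K twice, because its right-hand side -q₁g' is linear in c and ‖c‖ ≤ w‖c‖ ≤
  -- K‖y₁‖.
  set B := 1 + K * ‖y₁‖ + (K * (β * (K * ‖y₁‖)) + K * ‖y₂‖) with hB
  have hq : ∀ c : ℂ × (Fin M → ℂ), jets a x m (fun t => -(comb φ c.2 t * dg a g t)) =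
      -jetMap a x m (dgFam a g φ) c := fun c => by
    rw [← h.jets_comb_mul_dg hxI hφ, ← jets_neg]
  refine ⟨B * C, w₀, by linarith, fun w hw => ?_⟩
  have hw1 : 1 ≤ w := hw₀.trans hw
  have hw0 : 0 < w := by linarith
  obtain ⟨hbij, hbd⟩ := hK w hw
  have huniq : ∀ F : ℝ → ℂ, ∃! c, SolvesCollocation a α w g φ x m F c := fun F => by
    simp only [h.solvesCollocation_iff hxI hφ]
    exact hbij.existsUnique _
  refine ⟨huniq _, fun c _ => huniq _, huniq _, fun c d e hc hd he => ?_⟩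
  rw [h.solvesCollocation_iff hxI hφ] at hc hd he
  rw [hq] at hd
  have bc : w * ‖c‖ ≤ K * ‖y₁‖ := (hbd c).trans_eq (congrArg (K * ‖·‖) hc)
  have be : w * ‖e‖ ≤ K * ‖y₂‖ := (hbd e).trans_eq (congrArg (K * ‖·‖) he)
  have hcn : ‖c‖ ≤ K * ‖y₁‖ := (le_mul_of_one_le_left (norm_nonneg c) hw1).trans bc
  have bd : w * ‖d‖ ≤ K * (β * (K * ‖y₁‖)) := by
    refine ((hbd d).trans_eq (congrArg (K * ‖·‖) hd)).trans ?_
    rw [norm_neg]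
    exact mul_le_mul_of_nonneg_left
      ((hβ c).trans (mul_le_mul_of_nonneg_left hcn hβ0)) hK0
  have p1 : 0 ≤ K * ‖y₁‖ := by positivity
  have p2 : 0 ≤ K * (β * (K * ‖y₁‖)) := by positivity
  have p3 : 0 ≤ K * ‖y₂‖ := by positivity
  have bde : w * ‖d + e‖ ≤ B := by
    have := mul_le_mul_of_nonneg_left (norm_add_le d e) hw0.le
    rw [hB]
    linarith
  have main := hC w hw1 B (by rw [hB]; linarith) c d e hc hd he (by rw [hB]; linarith) bde
  have hpow : w ^ (-(s : ℝ) - 1 - min (1 + α) 1) =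
      (w ^ (s + 1))⁻¹ * w ^ (-min (1 + α) 1) := by
    rw [← Real.rpow_natCast, ← Real.rpow_neg hw0.le, ← Real.rpow_add hw0]
    congr 1
    push_cast
    ring
  have hwp : 0 < w ^ (s + 1) := by positivity
  rw [hpow]
  calc ‖oscIntegral a α w g f - levinLog a α w g φ e c d‖
      ≤ B * C * oscRate α w / w ^ (s + 1) := by
        rw [le_div_iff₀ hwp, mul_comm]; exact main
    _ = _ := by rw [oscRate, div_eq_mul_inv]; ring
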